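/- **Conventions.** Let $N\ge 2$, $1\le r<N$, and let $q>0$ be a real number with $q\ne 1$. Let $(a_{ij})_{1\le i,j\le N-1}$ be the Cartan matrix of type $A_{N-1}$. $U_q(\mathfrak{sl}(N))$ is the complex algebra with generators $E_i,F_i,K_i,K_i^{-1}$ ($1\le i\le N-1$) and relations $K_iK_i^{-1}=K_i^{-1}K_i=1$, $K_iK_j=K_jK_i$, $K_iE_jK_i^{-1}=q^{a_{ij}}E_j$, $K_iF_jK_i^{-1}=q^{-a_{ij}}F_j$, $E_iF_j-F_jE_i=\delta_{ij}\frac{K_i-K_i^{-1}}{q-q^{-1}}$ and the quantum Serre relations, with coproduct $\Delta(K_i)=K_i\otimes K_i$, $\Delta(E_i)=E_i\otimes K_i+1\otimes E_i$, $\Delta(F_i)=F_i\otimes 1+K_i^{-1}\otimes F_i$, counit $\varepsilon(K_i)=1$, $\varepsilon(E_i)=\varepsilon(F_i)=0$, antipode $S(K_i)=K_i^{-1}$, $S(E_i)=-E_iK_i^{-1}$, $S(F_i)=-K_iF_i$, and the involution (conjugate-linear anti-automorphism) $K_i^*=K_i$, $E_i^*=K_iF_i$, $F_i^*=E_iK_i^{-1}$.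 For $\lambda=\sum_i n_i\alpha_i$ in the root lattice put $K_\lambda=\prod_iK_i^{n_i}$; in particular $2\rho=\sum_k k(N-k)\alpha_k$ is the sum of the positive roots. $\mathbb{C}_q[SL(N)]$ is the span, in the linear dual of $U_q(\mathfrak{sl}(N))$, of the matrix coefficients of the finite-dimensional type 1 representations; it is a $*$-algebra for the convolution product $(ab)(X)=(a\otimes b)(\Delta(X))$, the unit $\varepsilon$ and $a^*(X)=\overline{a(S(X)^*)}$, and carries the actions $(X\triangleright a)(Y)=a(YX)$, $(a\triangleleft X)(Y)=a(XY)$. Let $U_q(\mathfrak{l}_S)$ be the subalgebra generated by all $K_\lambda$ and by $E_i,F_i$ with $i\ne r$. The quantum Grassmannian is the algebra $$\mathbb{C}_q[Gr(r,N)]=\{a\in\mathbb{C}_q[SL(N)] : a\triangleleft X=\varepsilon(X)a\ \text{ for all } X\in U_q(\mathfrak{l}_S)\}.$$ The automorphism $\theta(a)=K_{2\rho}\triangleright a\triangleleft K_{2\rho}$ of $\mathbb{C}_q[SL(N)]$ (the modular automorphism of the Haar state) restricts to it. The fundamental representation $\pi$ on $\mathbb{C}^N$, with orthonormal basis $v_1,\dots,v_N$,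 is $$K_kv_i=q^{\delta_{i,k}-\delta_{i,k+1}}v_i,\qquad E_kv_i=\delta_{i,k+1}q^{-1/2}v_{i-1},\qquad F_kv_i=\delta_{i,k}q^{1/2}v_{i+1}.$$ Let $f^1,\dots,f^N$ be the dual basis, with $(Xf)(v)=f(S(X)v)$, and let $u^i_j(X)$ be the coefficient of $v_i$ in $Xv_j$. Define matrices $M^n_m$ over $\mathbb{C}_q[SL(N)]$ by $(M^n_m)^i_j=(u^m_i)^*u^n_j$, and put $$P=\sum_{m=1}^{r}M^m_m .$$ Write $V=\pi(K_{2\rho}^{-1})$, a scalar matrix of size $N$, and $[r]_q=\frac{q^r-q^{-r}}{q-q^{-1}}$. For a complex algebra $A$ with an algebra endomorphism $\sigma$, the twisted Hochschild complex is $C_n=A\otimes A^{\otimes n}$ with $$b_\sigma(m\otimes a_1\otimes\cdots\otimes a_n)=ma_1\otimes a_2\otimes\cdots\otimes a_n+\sum_{i=1}^{n-1}(-1)^i m\otimes\cdots\otimes a_ia_{i+1}\otimes\cdots\otimes a_n+(-1)^n\sigma(a_n)m\otimes a_1\otimes\cdots\otimes a_{n-1},$$ and $H_n^\sigma(A)$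 is its homology. The normalized complex is its quotient by the span of the tensors $m\otimes a_1\otimes\cdots\otimes a_n$ with some $a_i=1$. **Statement.** 1. The vector $w=\sum_{m=1}^{r}v_m\otimes f^m$ is invariant under $U_q(\mathfrak{l}_S)$: $X\triangleright w=\varepsilon(X)w$ for all $X\in U_q(\mathfrak{l}_S)$, where $X\triangleright(v\otimes f)=X_{(1)}v\otimes X_{(2)}f$. 2. All entries of $P$ lie in $\mathbb{C}_q[Gr(r,N)]$, and $$P^*=P,\qquad P^2=P,\qquad \mathrm{Tr}(VP)=q^{r-N}[r]_q\,1 .$$ 3. The chain $$C(P)=\mathrm{Tr}\bigl(V(2P-\mathrm{Id})\otimes P\otimes P\bigr)=\sum_{j,k,l}\bigl(V(2P-\mathrm{Id})\bigr)_{jk}\otimes P_{kl}\otimes P_{lj}$$ is a cycle in the normalized $\theta$-twisted Hochschild complex of $\mathbb{C}_q[Gr(r,N)]$, and its class there is non-zero. Under the canonical map from $H_2^\theta(\mathbb{C}_q[Gr(r,N)])$ to the homology of the normalized complex, exactly one class is mapped to the class of $C(P)$. This class $[C(P)]\in H_2^\theta(\mathbb{C}_q[Gr(r,N)])$ is non-zero.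 -/

import Mathlib

open scoped TensorProduct

namespace QGrass

noncomputable section

/-- The defining relations of `U_q(sl(n + 1))` for families `E`, `F`, `K`, `L` (with `L i = (K i)⁻¹`)
of elements of a complex algebra. Only used to build homomorphisms out of `Uq`. -/
structure QRel (n : ℕ) (q : ℝ) {A : Type} [Ring A] [Algebra ℂ A]
    (E F K L : Fin n → A) : Prop where
  K_mul_L : ∀ i, K i * L i = 1
  L_mul_K : ∀ i, L i * K i = 1
  K_comm : ∀ i j, K i * K j = K j * K i
  K_E : ∀ i j, K i * E j * L i = (q : ℂ) ^ (CartanMatrix.A n i j) • E j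
  K_F : ∀ i j, K i * F j * L i = (q : ℂ) ^ (-CartanMatrix.A n i j) • F j
  E_F : ∀ i j, E i * F j - F j * E i =
    if i = j then ((q : ℂ) - (q : ℂ)⁻¹)⁻¹ • (K i - L i) else 0
  E_comm : ∀ i j, CartanMatrix.A n i j = 0 → E i * E j = E j * E i
  F_comm : ∀ i j, CartanMatrix.A n i j = 0 → F i * F j = F j * F i
  serre_E : ∀ i j, CartanMatrix.A n i j = -1 →
    E i * E i * E j - ((q : ℂ) + (q : ℂ)⁻¹) • (E i * E j * E i) + E j * E i * E i = 0
  serre_F : ∀ i j, CartanMatrix.A n i j = -1 →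
    F i * F i * F j - ((q : ℂ) + (q : ℂ)⁻¹) • (F i * F j * F i) + F j * F i * F i = 0

theorem serre_add {A : Type} [Ring A] [Algebra ℂ A] {Q : ℂ} (hQ : Q ≠ 0) {x₁ x₂ y₁ y₂ : A}
    (h11 : y₁ * x₁ = (Q⁻¹ ^ 2) • (x₁ * y₁)) (h12 : y₁ * x₂ = Q • (x₂ * y₁))
    (h21 : y₂ * x₁ = Q • (x₁ * y₂))
    (hx : x₁ * x₁ * x₂ - (Q + Q⁻¹) • (x₁ * x₂ * x₁) + x₂ * x₁ * x₁ = 0)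
    (hy : y₁ * y₁ * y₂ - (Q + Q⁻¹) • (y₁ * y₂ * y₁) + y₂ * y₁ * y₁ = 0) :
    (x₁ + y₁) * (x₁ + y₁) * (x₂ + y₂) - (Q + Q⁻¹) • ((x₁ + y₁) * (x₂ + y₂) * (x₁ + y₁))
      + (x₂ + y₂) * (x₁ + y₁) * (x₁ + y₁) = 0 := by
  have a11 : ∀ z, y₁ * (x₁ * z) = (Q⁻¹ ^ 2) • (x₁ * (y₁ * z)) := fun z => by
    rw [← mul_assoc, h11, smul_mul_assoc, mul_assoc]
  have a12 : ∀ z, y₁ * (x₂ * z) = Q • (x₂ * (y₁ * z)) := fun z => by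
    rw [← mul_assoc, h12, smul_mul_assoc, mul_assoc]
  have a21 : ∀ z, y₂ * (x₁ * z) = Q • (x₁ * (y₂ * z)) := fun z => by
    rw [← mul_assoc, h21, smul_mul_assoc, mul_assoc]
  have hx' : x₁ * (x₁ * x₂) = (Q + Q⁻¹) • (x₁ * (x₂ * x₁)) - x₂ * (x₁ * x₁) := by
    simp only [mul_assoc] at hx
    rw [← sub_eq_zero, ← hx]; abel
  have hy' : y₁ * (y₁ * y₂) = (Q + Q⁻¹) • (y₁ * (y₂ * y₁)) - y₂ * (y₁ * y₁) := by
    simp only [mul_assoc] at hy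
    rw [← sub_eq_zero, ← hy]; abel
  simp only [mul_add, add_mul, mul_assoc, h11, h12, h21, a11, a12, a21, smul_mul_assoc,
    mul_smul_comm, hx', hy', smul_add, smul_sub]
  match_scalars <;> field_simp <;> ring

/-- Moving Cartan elements: if `x = e k`, `y = f l`. -/
theorem serre_twist {A : Type} [Ring A] [Algebra ℂ A] {Q : ℂ} (hQ : Q ≠ 0) {c : ℂ}
    {e₁ e₂ k₁ k₂ : A} (hk : k₁ * k₂ = k₂ * k₁)
    (h11 : k₁ * e₁ = (Q⁻¹ ^ 2) • (e₁ * k₁)) (h12 : k₁ * e₂ = Q • (e₂ * k₁))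
    (h21 : k₂ * e₁ = Q • (e₁ * k₂))
    (hx : e₁ * e₁ * e₂ - c • (e₁ * e₂ * e₁) + e₂ * e₁ * e₁ = 0) :
    (e₁ * k₁) * (e₁ * k₁) * (e₂ * k₂) - c • ((e₁ * k₁) * (e₂ * k₂) * (e₁ * k₁))
      + (e₂ * k₂) * (e₁ * k₁) * (e₁ * k₁) = 0 := by
  have a11 : ∀ z, k₁ * (e₁ * z) = (Q⁻¹ ^ 2) • (e₁ * (k₁ * z)) := fun z => by
    rw [← mul_assoc, h11, smul_mul_assoc, mul_assoc]
  have a12 : ∀ z, k₁ * (e₂ * z) = Q • (e₂ * (k₁ * z)) := fun z => by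
    rw [← mul_assoc, h12, smul_mul_assoc, mul_assoc]
  have a21 : ∀ z, k₂ * (e₁ * z) = Q • (e₁ * (k₂ * z)) := fun z => by
    rw [← mul_assoc, h21, smul_mul_assoc, mul_assoc]
  have ak : ∀ z, k₂ * (k₁ * z) = (k₁ * (k₂ * z)) := fun z => by
    rw [← mul_assoc, ← hk, mul_assoc]
  have hx' : ∀ z, e₁ * (e₁ * (e₂ * z)) = c • (e₁ * (e₂ * (e₁ * z))) - e₂ * (e₁ * (e₁ * z)) := by
    intro z
    have := congrArg (· * z) hx
    simp only [mul_assoc, sub_mul, add_mul, smul_mul_assoc, zero_mul] at this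
    rw [← sub_eq_zero, ← this]; abel
  simp only [mul_assoc, h11, h12, h21, a11, a12, a21, smul_mul_assoc,
    mul_smul_comm, hx', smul_sub, ← hk, ak]
  match_scalars <;> field_simp <;> ring

namespace QRel

variable {n : ℕ} {q : ℝ} {A : Type} [Ring A] [Algebra ℂ A] {E F K L : Fin n → A}

theorem KE (h : QRel n q E F K L) (i j : Fin n) :
    K i * E j = (q : ℂ) ^ (CartanMatrix.A n i j) • (E j * K i) := by
  rw [← smul_mul_assoc, ← h.K_E, mul_assoc, h.L_mul_K, mul_one]

theorem KF (h : QRel n q E F K L) (i j : Fin n) :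
    K i * F j = (q : ℂ) ^ (-CartanMatrix.A n i j) • (F j * K i) := by
  rw [← smul_mul_assoc, ← h.K_F, mul_assoc, h.L_mul_K, mul_one]

theorem LE (hq : (q : ℂ) ≠ 0) (h : QRel n q E F K L) (i j : Fin n) :
    L i * E j = (q : ℂ) ^ (-CartanMatrix.A n i j) • (E j * L i) := by
  have h1 : E j = (q : ℂ) ^ (-CartanMatrix.A n i j) • (K i * E j * L i) := by
    rw [h.K_E, smul_smul, ← zpow_add₀ hq]; simp
  conv_lhs => rw [h1]
  rw [mul_smul_comm, ← mul_assoc, ← mul_assoc, h.L_mul_K, one_mul]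

theorem LF (hq : (q : ℂ) ≠ 0) (h : QRel n q E F K L) (i j : Fin n) :
    L i * F j = (q : ℂ) ^ (CartanMatrix.A n i j) • (F j * L i) := by
  have h1 : F j = (q : ℂ) ^ (CartanMatrix.A n i j) • (K i * F j * L i) := by
    rw [h.K_F, smul_smul, ← zpow_add₀ hq]; simp
  conv_lhs => rw [h1]
  rw [mul_smul_comm, ← mul_assoc, ← mul_assoc, h.L_mul_K, one_mul]

theorem L_comm (h : QRel n q E F K L) (i j : Fin n) : L i * L j = L j * L i := by
  have hc : Commute (K i) (K j) := h.K_comm i j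
  let u : Aˣ := ⟨K i, L i, h.K_mul_L i, h.L_mul_K i⟩
  let v : Aˣ := ⟨K j, L j, h.K_mul_L j, h.L_mul_K j⟩
  have : Commute u v := Units.ext hc
  exact congrArg Units.val (this.inv_inv).eq

theorem KL_comm (h : QRel n q E F K L) (i j : Fin n) : K i * L j = L j * K i := by
  have hc : Commute (K i) (K j) := h.K_comm i j
  let u : Aˣ := ⟨K i, L i, h.K_mul_L i, h.L_mul_K i⟩
  let v : Aˣ := ⟨K j, L j, h.K_mul_L j, h.L_mul_K j⟩
  have : Commute u v := Units.ext hc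
  exact congrArg Units.val (this.inv_right).eq

end QRel

theorem A_symm {n : ℕ} (i j : Fin n) : CartanMatrix.A n i j = CartanMatrix.A n j i := by
  simp only [CartanMatrix.A, Matrix.of_apply]
  grind

theorem A_self {n : ℕ} (i : Fin n) : CartanMatrix.A n i i = 2 := by
  simp [CartanMatrix.A]

namespace QRel
variable {n : ℕ} {q : ℝ} {A : Type} [Ring A] [Algebra ℂ A] {E F K L : Fin n → A}
 {B : Type} [Ring B] [Algebra ℂ B] {E' F' K' L' : Fin n → B}

theorem tensor (hq : (q : ℂ) ≠ 0) (h : QRel n q E F K L) (h' : QRel n q E' F' K' L') :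
    QRel n q (A := A ⊗[ℂ] B) (fun i => E i ⊗ₜ[ℂ] K' i + 1 ⊗ₜ[ℂ] E' i)
      (fun i => F i ⊗ₜ[ℂ] 1 + L i ⊗ₜ[ℂ] F' i) (fun i => K i ⊗ₜ[ℂ] K' i)
      (fun i => L i ⊗ₜ[ℂ] L' i) := by
  constructor
  · intro i; simp [h.K_mul_L, h'.K_mul_L, Algebra.TensorProduct.one_def]
  · intro i; simp [h.L_mul_K, h'.L_mul_K, Algebra.TensorProduct.one_def]
  · intro i j; simp [h.K_comm i j, h'.K_comm i j]
  · intro i j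
    simp only [mul_add, add_mul, Algebra.TensorProduct.tmul_mul_tmul, mul_one, h.K_E, h'.K_E,
      h.K_mul_L]
    rw [h'.K_comm i j, mul_assoc (K' j), h'.K_mul_L, mul_one, TensorProduct.tmul_smul,
      ← TensorProduct.smul_tmul', smul_add]
  · intro i j
    simp only [mul_add, add_mul, Algebra.TensorProduct.tmul_mul_tmul, mul_one, h.K_F, h'.K_F,
      h'.K_mul_L]
    rw [h.KL_comm i j, mul_assoc (L j), h.K_mul_L, mul_one, TensorProduct.tmul_smul,
      ← TensorProduct.smul_tmul', smul_add]
  · intro i j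
    have e1 := h.E_F i j
    have e2 := h'.E_F i j
    have e3 : E i * L j = (q : ℂ) ^ (CartanMatrix.A n j i) • (L j * E i) := by
      rw [h.LE hq, smul_smul, ← zpow_add₀ hq]; simp
    have e4 : K' i * F' j = (q : ℂ) ^ (-CartanMatrix.A n j i) • (F' j * K' i) := by
      rw [h'.KF, A_symm]
    have key : (E i ⊗ₜ[ℂ] K' i + 1 ⊗ₜ[ℂ] E' i) * (F j ⊗ₜ[ℂ] 1 + L j ⊗ₜ[ℂ] F' j) -
        (F j ⊗ₜ[ℂ] 1 + L j ⊗ₜ[ℂ] F' j) * (E i ⊗ₜ[ℂ] K' i + 1 ⊗ₜ[ℂ] E' i) =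
        (E i * F j - F j * E i) ⊗ₜ[ℂ] K' i + L j ⊗ₜ[ℂ] (E' i * F' j - F' j * E' i) := by
      simp only [mul_add, add_mul, Algebra.TensorProduct.tmul_mul_tmul, mul_one, one_mul, e3, e4,
        TensorProduct.tmul_smul, TensorProduct.sub_tmul, TensorProduct.tmul_sub]
      rw [← TensorProduct.smul_tmul', smul_smul, ← zpow_add₀ hq]
      simp
      abel
    rw [key, e1, e2]
    split_ifs with hij
    · subst hij
      simp only [← TensorProduct.smul_tmul', TensorProduct.tmul_smul, TensorProduct.sub_tmul,
        TensorProduct.tmul_sub, ← smul_add]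
      congr 1; abel
    · simp
  · intro i j hij
    have e1 := h.E_comm i j hij
    have e2 := h'.E_comm i j hij
    have e3 := h'.KE i j
    have e4 := h'.KE j i
    rw [A_symm] at e4
    rw [hij, zpow_zero, one_smul] at e3 e4
    simp only [mul_add, add_mul, Algebra.TensorProduct.tmul_mul_tmul, mul_one, one_mul, e1, e2, e3,
      e4, h'.K_comm i j]
    abel
  · intro i j hij
    have e1 := h.F_comm i j hij
    have e2 := h'.F_comm i j hij
    have e3 := h.LF hq i j
    have e4 := h.LF hq j i
    rw [A_symm] at e4
    rw [hij, zpow_zero, one_smul] at e3 e4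
    simp only [mul_add, add_mul, Algebra.TensorProduct.tmul_mul_tmul, mul_one, one_mul, e1, e2, e3,
      e4, h.L_comm i j]
    abel
  · intro i j hij
    have hji : CartanMatrix.A n j i = -1 := by rw [A_symm, hij]
    apply serre_add hq
    · simp only [Algebra.TensorProduct.tmul_mul_tmul, one_mul, mul_one, h'.KE, A_self,
        TensorProduct.tmul_smul, smul_smul]
      rw [inv_pow, ← zpow_natCast, Nat.cast_ofNat, inv_mul_cancel₀ (zpow_ne_zero _ hq), one_smul]
    · simp only [Algebra.TensorProduct.tmul_mul_tmul, one_mul, mul_one, h'.KE, hij, hji,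
        TensorProduct.tmul_smul, smul_smul]
      simp [hq]
    · simp only [Algebra.TensorProduct.tmul_mul_tmul, one_mul, mul_one, h'.KE, hij, hji,
        TensorProduct.tmul_smul, smul_smul]
      simp [hq]
    · have := congrArg (· ⊗ₜ[ℂ] (K' i * K' i * K' j)) (h.serre_E i j hij)
      simp only [TensorProduct.add_tmul, TensorProduct.sub_tmul, TensorProduct.zero_tmul,
        ← TensorProduct.smul_tmul'] at this
      have hK1 : K' i * K' j * K' i = K' i * K' i * K' j := by
        rw [mul_assoc, h'.K_comm j i, ← mul_assoc]
      have hK2 : K' j * K' i * K' i = K' i * K' i * K' j := by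
        rw [h'.K_comm j i, hK1]
      simp only [Algebra.TensorProduct.tmul_mul_tmul, hK1, hK2, this]
    · have := congrArg ((1:A) ⊗ₜ[ℂ] ·) (h'.serre_E i j hij)
      simpa [TensorProduct.tmul_add, TensorProduct.tmul_sub] using this
  · intro i j hij
    have hji : CartanMatrix.A n j i = -1 := by rw [A_symm, hij]
    have := serre_add (inv_ne_zero hq) (x₁ := F i ⊗ₜ[ℂ] (1 : B)) (x₂ := F j ⊗ₜ[ℂ] (1 : B))
      (y₁ := L i ⊗ₜ[ℂ] F' i) (y₂ := L j ⊗ₜ[ℂ] F' j) ?_ ?_ ?_ ?_ ?_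
    · simpa [add_comm (q : ℂ)⁻¹] using this
    · simp only [Algebra.TensorProduct.tmul_mul_tmul, one_mul, mul_one, h.LF hq, A_self,
        ← TensorProduct.smul_tmul']
      rw [inv_inv, ← zpow_natCast, Nat.cast_ofNat]
    · simp only [Algebra.TensorProduct.tmul_mul_tmul, one_mul, mul_one, h.LF hq, hij, hji,
        ← TensorProduct.smul_tmul']
      simp
    · simp only [Algebra.TensorProduct.tmul_mul_tmul, one_mul, mul_one, h.LF hq, hij, hji,
        ← TensorProduct.smul_tmul']
      simp
    · have := congrArg (· ⊗ₜ[ℂ] (1 : B)) (h.serre_F i j hij)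
      simpa [TensorProduct.add_tmul, TensorProduct.sub_tmul, ← TensorProduct.smul_tmul',
        add_comm (q : ℂ)⁻¹] using this
    · have := congrArg ((L i * L i * L j) ⊗ₜ[ℂ] ·) (h'.serre_F i j hij)
      simp only [TensorProduct.tmul_add, TensorProduct.tmul_sub, TensorProduct.tmul_zero,
        TensorProduct.tmul_smul] at this
      have hL1 : L i * L j * L i = L i * L i * L j := by
        rw [mul_assoc, h.L_comm j i, ← mul_assoc]
      have hL2 : L j * L i * L i = L i * L i * L j := by
        rw [h.L_comm j i, hL1]
      simp only [Algebra.TensorProduct.tmul_mul_tmul, hL1, hL2, inv_inv, add_comm (q : ℂ)⁻¹, this]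


open MulOpposite in
theorem antipode (hq : (q : ℂ) ≠ 0) (h : QRel n q E F K L) :
    QRel n q (A := Aᵐᵒᵖ) (fun i => op (-(E i * L i))) (fun i => op (-(K i * F i)))
      (fun i => op (L i)) (fun i => op (K i)) := by
  have hEL : ∀ i j, E i * L j = (q : ℂ) ^ (CartanMatrix.A n j i) • (L j * E i) := by
    intro i j; rw [h.LE hq, smul_smul, ← zpow_add₀ hq]; simp
  have hFK : ∀ i j, F i * K j = (q : ℂ) ^ (CartanMatrix.A n j i) • (K j * F i) := by
    intro i j; rw [h.KF, smul_smul, ← zpow_add₀ hq]; simp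
  constructor
  · intro i; rw [← op_mul, h.K_mul_L, op_one]
  · intro i; rw [← op_mul, h.L_mul_K, op_one]
  · intro i j; rw [← op_mul, ← op_mul, h.L_comm]
  · intro i j
    rw [← op_mul, ← op_mul, ← op_smul]
    congr 1
    rw [neg_mul, mul_neg, smul_neg, mul_assoc, h.L_comm j i, ← mul_assoc, ← mul_assoc,
      h.KE, smul_mul_assoc, smul_mul_assoc, mul_assoc (E j), h.K_mul_L, mul_one]
  · intro i j
    rw [← op_mul, ← op_mul, ← op_smul]
    congr 1
    rw [neg_mul, mul_neg, smul_neg, ← mul_assoc (K i), ← mul_assoc (K i), h.K_comm i j,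
      mul_assoc (K j), mul_assoc (K j), h.K_F, mul_smul_comm]
  · intro i j
    rw [← op_mul, ← op_mul, ← op_sub]
    have key : -(K j * F j) * -(E i * L i) - -(E i * L i) * -(K j * F j) =
        -(K j * (E i * F j - F j * E i) * L i) := by
      have e1 : E i * L i * (K j * F j) = K j * (E i * F j) * L i := by
        rw [mul_assoc, ← mul_assoc (L i), ← h.KL_comm, mul_assoc (K j), h.LF hq, ← mul_assoc (K j),
          h.KE, smul_mul_assoc, mul_smul_comm, mul_smul_comm, smul_mul_assoc, A_symm]
        simp only [mul_assoc]
      rw [neg_mul_neg, neg_mul_neg, e1, mul_sub, sub_mul]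
      simp only [mul_assoc]
      abel
    rw [key, h.E_F]
    split_ifs with hij
    · subst hij
      rw [← op_sub, ← op_smul, mul_smul_comm, smul_mul_assoc, ← smul_neg, mul_sub, sub_mul,
        mul_assoc, h.K_mul_L, mul_one, one_mul, neg_sub]
    · simp
  · intro i j hij
    have hji : CartanMatrix.A n j i = 0 := by rw [A_symm, hij]
    have e1 := h.LE hq i j
    have e2 := h.LE hq j i
    rw [hij, neg_zero, zpow_zero, one_smul] at e1
    rw [hji, neg_zero, zpow_zero, one_smul] at e2
    rw [← op_mul, ← op_mul]
    congr 1
    rw [neg_mul_neg, neg_mul_neg, mul_assoc, ← mul_assoc (L j), e2, mul_assoc (E i), h.L_comm j i,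
      ← mul_assoc, ← h.E_comm i j hij, mul_assoc, mul_assoc, ← mul_assoc (L i), e1]
    simp only [mul_assoc]
  · intro i j hij
    have hji : CartanMatrix.A n j i = 0 := by rw [A_symm, hij]
    have e1 := h.KF i j
    have e2 := h.KF j i
    rw [hij, neg_zero, zpow_zero, one_smul] at e1
    rw [hji, neg_zero, zpow_zero, one_smul] at e2
    rw [← op_mul, ← op_mul]
    congr 1
    rw [neg_mul_neg, neg_mul_neg, mul_assoc, ← mul_assoc (F j), ← e1, mul_assoc (K i) (F j),
      ← h.F_comm i j hij, ← mul_assoc, h.K_comm j i, mul_assoc, mul_assoc, ← mul_assoc (F i), ← e2,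
      mul_assoc]
  · intro i j hij
    have hji : CartanMatrix.A n j i = -1 := by rw [A_symm, hij]
    have := serre_twist hq (h.L_comm i j) ?_ ?_ ?_ (h.serre_E i j hij)
    · simp only [← op_mul, ← op_smul, ← op_sub, ← op_add]
      rw [← op_zero]
      congr 1
      rw [← neg_eq_zero] at this
      rw [← this]
      simp only [neg_mul, mul_neg, smul_neg, neg_neg, mul_assoc]
      abel
    · rw [h.LE hq, A_self, inv_pow, zpow_neg, ← zpow_natCast, Nat.cast_ofNat]
    · rw [h.LE hq, hij]; simp
    · rw [h.LE hq, hji]; simp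
  · intro i j hij
    have hji : CartanMatrix.A n j i = -1 := by rw [A_symm, hij]
    have hs : ∀ i j, CartanMatrix.A n i j = -1 → K i * F j = (q : ℂ) • (F j * K i) := by
      intro i j hij
      rw [h.KF, hij]; simp
    have hd : ∀ i, K i * F i = ((q : ℂ)⁻¹ ^ 2) • (F i * K i) := by
      intro i
      rw [h.KF, A_self, inv_pow, zpow_neg, ← zpow_natCast, Nat.cast_ofNat]
    have := serre_twist hq (h.K_comm i j) (hd i) (hs i j hij) (hs j i hji) (h.serre_F i j hij)
    have h3 : -(((q : ℂ)⁻¹ ^ 2) • ((q : ℂ)⁻¹ ^ 2) • ((q : ℂ)⁻¹ ^ 2) • (F i * K i * (F i * K i) * (F j * K j) -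
      ((q : ℂ) + (q : ℂ)⁻¹) • (F i * K i * (F j * K j) * (F i * K i)) +
        F j * K j * (F i * K i) * (F i * K i))) = 0 := by rw [this]; simp
    simp only [← op_mul, ← op_smul, ← op_sub, ← op_add]
    rw [← op_zero]
    congr 1
    rw [← h3]
    simp only [hd, neg_mul, mul_neg, smul_neg, neg_neg, mul_assoc, smul_mul_assoc, mul_smul_comm,
      smul_add, smul_sub]
    module

end QRel

/-- The opposite algebra with the complex-conjugate scalar action, so that an algebra homomorphism
`A →ₐ[ℂ] ConjOp B` is the same thing as a conjugate-linear anti-homomorphism `A → B`. -/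
def ConjOp (A : Type) : Type := Aᵐᵒᵖ

instance {A : Type} [Ring A] : Ring (ConjOp A) := inferInstanceAs (Ring Aᵐᵒᵖ)

instance {A : Type} [Ring A] [Algebra ℂ A] : Algebra ℂ (ConjOp A) :=
  RingHom.toAlgebra' ((algebraMap ℂ Aᵐᵒᵖ).comp (starRingEnd ℂ))
    (fun c x => Algebra.commutes (A := Aᵐᵒᵖ) (starRingEnd ℂ c) x)

/-- The canonical map to `ConjOp A`. -/
def ConjOp.mk {A : Type} (a : A) : ConjOp A := MulOpposite.op a

/-- The canonical map from `ConjOp A`. -/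
def ConjOp.un {A : Type} (a : ConjOp A) : A := MulOpposite.unop a

section
variable {A : Type} [Ring A] [Algebra ℂ A]
theorem ConjOp.mk_mul (a b : A) : ConjOp.mk (a * b) = ConjOp.mk b * ConjOp.mk a := rfl
theorem ConjOp.mk_sub (a b : A) : ConjOp.mk (a - b) = ConjOp.mk a - ConjOp.mk b := rfl
theorem ConjOp.mk_add (a b : A) : ConjOp.mk (a + b) = ConjOp.mk a + ConjOp.mk b := rfl
theorem ConjOp.mk_one : ConjOp.mk (1 : A) = 1 := rfl
theorem ConjOp.mk_zero : ConjOp.mk (0 : A) = 0 := rfl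
theorem ConjOp.mk_smul (c : ℂ) (a : A) :
    ConjOp.mk (starRingEnd ℂ c • a) = c • ConjOp.mk a := by
  rw [Algebra.smul_def, Algebra.smul_def, ConjOp.mk_mul]
  exact (Algebra.commutes (A := ConjOp A) c (ConjOp.mk a)).symm
theorem ConjOp.smul_mk {c : ℂ} (hc : starRingEnd ℂ c = c) (a : A) :
     c • ConjOp.mk a = ConjOp.mk (c • a) := by
  rw [← ConjOp.mk_smul, hc]
end

namespace QRel
variable {n : ℕ} {q : ℝ} {A : Type} [Ring A] [Algebra ℂ A] {E F K L : Fin n → A}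

theorem compact (hq : (q : ℂ) ≠ 0) (h : QRel n q E F K L) :
    QRel n q (A := ConjOp A) (fun i => ConjOp.mk (K i * F i)) (fun i => ConjOp.mk (E i * L i))
      (fun i => ConjOp.mk (K i)) (fun i => ConjOp.mk (L i)) := by
  have hz : ∀ m : ℤ, starRingEnd ℂ ((q : ℂ) ^ m) = (q : ℂ) ^ m := by
    intro m; simp
  have hc : starRingEnd ℂ ((q : ℂ) + (q : ℂ)⁻¹) = (q : ℂ) + (q : ℂ)⁻¹ := by simp
  have hd : starRingEnd ℂ ((q : ℂ) - (q : ℂ)⁻¹)⁻¹ = ((q : ℂ) - (q : ℂ)⁻¹)⁻¹ := by simp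
  have a := h.antipode hq
  constructor
  · intro i; rw [← ConjOp.mk_mul, h.L_mul_K, ConjOp.mk_one]
  · intro i; rw [← ConjOp.mk_mul, h.K_mul_L, ConjOp.mk_one]
  · intro i j; rw [← ConjOp.mk_mul, ← ConjOp.mk_mul, h.K_comm]
  · intro i j
    rw [← ConjOp.mk_mul, ← ConjOp.mk_mul, ConjOp.smul_mk (hz _)]
    congr 1
    rw [mul_assoc (K j), ← mul_assoc (L i), ← h.KL_comm, mul_assoc, ← mul_assoc (L i), h.LF hq,
      smul_mul_assoc, mul_assoc, h.L_mul_K, mul_one, mul_smul_comm]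
  · intro i j
    rw [← ConjOp.mk_mul, ← ConjOp.mk_mul, ConjOp.smul_mk (hz _)]
    congr 1
    rw [mul_assoc, ← h.KL_comm, ← mul_assoc (E j), ← mul_assoc (L i), ← mul_assoc (L i), h.LE hq,
      smul_mul_assoc, smul_mul_assoc, mul_assoc (E j), h.L_mul_K, mul_one]
  · intro i j
    have key := congrArg MulOpposite.unop (a.E_F j i)
    rw [← ConjOp.mk_mul, ← ConjOp.mk_mul, ← ConjOp.mk_sub, ← ConjOp.mk_sub,
      ConjOp.smul_mk hd, ← ConjOp.mk_zero]
    rw [← apply_ite ConjOp.mk]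
    congr 1
    simp only [MulOpposite.unop_sub, MulOpposite.unop_mul, MulOpposite.unop_op, neg_mul_neg] at key
    rw [← neg_sub, key]
    by_cases hij : i = j
    · subst hij
      simp [← smul_neg]
    · simp [hij, Ne.symm hij]
  · intro i j hij
    have key := congrArg MulOpposite.unop (a.F_comm i j hij)
    rw [← ConjOp.mk_mul, ← ConjOp.mk_mul]
    exact congrArg ConjOp.mk (by simpa using key)
  · intro i j hij
    have key := congrArg MulOpposite.unop (a.E_comm i j hij)
    rw [← ConjOp.mk_mul, ← ConjOp.mk_mul]
    exact congrArg ConjOp.mk (by simpa using key)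
  · intro i j hij
    have key := congrArg MulOpposite.unop (a.serre_F i j hij)
    simp only [← ConjOp.mk_mul, ← ConjOp.mk_sub, ConjOp.smul_mk hc, ← ConjOp.mk_add]
    rw [← ConjOp.mk_zero]
    congr 1
    rw [← neg_eq_zero, ← MulOpposite.unop_zero, ← key]
    simp only [MulOpposite.unop_sub, MulOpposite.unop_add, MulOpposite.unop_smul,
      MulOpposite.unop_mul, MulOpposite.unop_op, neg_mul, mul_neg, smul_neg, neg_neg]
    abel
  · intro i j hij
    have key := congrArg MulOpposite.unop (a.serre_E i j hij)
    simp only [← ConjOp.mk_mul, ← ConjOp.mk_sub, ConjOp.smul_mk hc, ← ConjOp.mk_add]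
    rw [← ConjOp.mk_zero]
    congr 1
    rw [← neg_eq_zero, ← MulOpposite.unop_zero, ← key]
    simp only [MulOpposite.unop_sub, MulOpposite.unop_add, MulOpposite.unop_smul,
      MulOpposite.unop_mul, MulOpposite.unop_op, neg_mul, mul_neg, smul_neg, neg_neg]
    abel
end QRel

/-- Generators `E_i, F_i, K_i, K_i⁻¹`, with `i : Fin n` standing for the simple root `α_(i+1)`. -/
inductive Gen (n : ℕ) : Type
  | E (i : Fin n)
  | F (i : Fin n)
  | K (i : Fin n)
  | Kinv (i : Fin n)

section
variable {n : ℕ}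
abbrev gE (i : Fin n) : FreeAlgebra ℂ (Gen n) := FreeAlgebra.ι ℂ (Gen.E i)
abbrev gF (i : Fin n) : FreeAlgebra ℂ (Gen n) := FreeAlgebra.ι ℂ (Gen.F i)
abbrev gK (i : Fin n) : FreeAlgebra ℂ (Gen n) := FreeAlgebra.ι ℂ (Gen.K i)
abbrev gKinv (i : Fin n) : FreeAlgebra ℂ (Gen n) := FreeAlgebra.ι ℂ (Gen.Kinv i)
end

/-- The defining relations of `U_q(sl(n + 1))`, with the Cartan matrix of type `A_n`. -/
inductive Rel (n : ℕ) (q : ℝ) : FreeAlgebra ℂ (Gen n) → FreeAlgebra ℂ (Gen n) → Prop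
  | K_mul_L (i) : Rel n q (gK i * gKinv i) 1
  | L_mul_K (i) : Rel n q (gKinv i * gK i) 1
  | K_comm (i j) : Rel n q (gK i * gK j) (gK j * gK i)
  | K_E (i j) : Rel n q (gK i * gE j * gKinv i) ((q : ℂ) ^ (CartanMatrix.A n i j) • gE j)
  | K_F (i j) : Rel n q (gK i * gF j * gKinv i) ((q : ℂ) ^ (-CartanMatrix.A n i j) • gF j)
  | E_F (i j) : Rel n q (gE i * gF j - gF j * gE i)
      (if i = j then ((q : ℂ) - (q : ℂ)⁻¹)⁻¹ • (gK i - gKinv i) else 0)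
  | E_comm (i j) : CartanMatrix.A n i j = 0 → Rel n q (gE i * gE j) (gE j * gE i)
  | F_comm (i j) : CartanMatrix.A n i j = 0 → Rel n q (gF i * gF j) (gF j * gF i)
  | serre_E (i j) : CartanMatrix.A n i j = -1 → Rel n q
      (gE i * gE i * gE j - ((q : ℂ) + (q : ℂ)⁻¹) • (gE i * gE j * gE i) + gE j * gE i * gE i) 0
  | serre_F (i j) : CartanMatrix.A n i j = -1 → Rel n q
      (gF i * gF i * gF j - ((q : ℂ) + (q : ℂ)⁻¹) • (gF i * gF j * gF i) + gF j * gF i * gF i) 0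

/-- The quantized enveloping algebra `U_q(sl(N))` over `ℂ`. -/
def Uq (N : ℕ) (q : ℝ) : Type := RingQuot (Rel (N - 1) q)

namespace Uq

instance (N : ℕ) (q : ℝ) : Ring (Uq N q) := inferInstanceAs (Ring (RingQuot (Rel (N - 1) q)))
instance (N : ℕ) (q : ℝ) : Algebra ℂ (Uq N q) :=
  inferInstanceAs (Algebra ℂ (RingQuot (Rel (N - 1) q)))

variable {N : ℕ} {q : ℝ}

def mk (N : ℕ) (q : ℝ) : FreeAlgebra ℂ (Gen (N - 1)) →ₐ[ℂ] Uq N q :=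
  RingQuot.mkAlgHom ℂ (Rel (N - 1) q)

def E (i : Fin (N - 1)) : Uq N q := mk N q (gE i)
def F (i : Fin (N - 1)) : Uq N q := mk N q (gF i)
def K (i : Fin (N - 1)) : Uq N q := mk N q (gK i)
def Kinv (i : Fin (N - 1)) : Uq N q := mk N q (gKinv i)

theorem mk_rel {x y : FreeAlgebra ℂ (Gen (N - 1))} (h : Rel (N - 1) q x y) : mk N q x = mk N q y :=
  RingQuot.mkAlgHom_rel ℂ h

theorem qrel (N : ℕ) (q : ℝ) : QRel (N - 1) q (A := Uq N q) E F K Kinv where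
  K_mul_L i := by simpa [E, F, K, Kinv] using mk_rel (Rel.K_mul_L (q := q) i)
  L_mul_K i := by simpa [E, F, K, Kinv] using mk_rel (Rel.L_mul_K (q := q) i)
  K_comm i j := by simpa [E, F, K, Kinv] using mk_rel (Rel.K_comm (q := q) i j)
  K_E i j := by simpa only [E, F, K, Kinv, map_mul, map_smul] using mk_rel (Rel.K_E (q := q) i j)
  K_F i j := by simpa only [E, F, K, Kinv, map_mul, map_smul] using mk_rel (Rel.K_F (q := q) i j)
  E_F i j := by
    have := mk_rel (Rel.E_F (q := q) i j)
    split_ifs at this ⊢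
    · simpa only [E, F, K, Kinv, map_mul, map_smul, map_sub] using this
    · simpa only [E, F, K, Kinv, map_mul, map_zero, map_sub] using this
  E_comm i j h := by simpa [E, F, K, Kinv] using mk_rel (Rel.E_comm (q := q) i j h)
  F_comm i j h := by simpa [E, F, K, Kinv] using mk_rel (Rel.F_comm (q := q) i j h)
  serre_E i j h := by
    simpa only [E, F, K, Kinv, map_mul, map_smul, map_sub, map_add, map_zero] using
      mk_rel (Rel.serre_E (q := q) i j h)
  serre_F i j h := by
    simpa only [E, F, K, Kinv, map_mul, map_smul, map_sub, map_add, map_zero] using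
      mk_rel (Rel.serre_F (q := q) i j h)

section lift
variable {A : Type} [Ring A] [Algebra ℂ A] {e f k l : Fin (N - 1) → A}

def freeLift (e f k l : Fin (N - 1) → A) : FreeAlgebra ℂ (Gen (N - 1)) →ₐ[ℂ] A :=
  FreeAlgebra.lift ℂ fun
    | Gen.E i => e i
    | Gen.F i => f i
    | Gen.K i => k i
    | Gen.Kinv i => l i

theorem freeLift_rel (h : QRel (N - 1) q e f k l) ⦃x y : FreeAlgebra ℂ (Gen (N - 1))⦄
    (r : Rel (N - 1) q x y) : freeLift e f k l x = freeLift e f k l y := by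
  have hE : ∀ i, freeLift e f k l (gE i) = e i := fun i => by simp [freeLift]
  have hF : ∀ i, freeLift e f k l (gF i) = f i := fun i => by simp [freeLift]
  have hK : ∀ i, freeLift e f k l (gK i) = k i := fun i => by simp [freeLift]
  have hL : ∀ i, freeLift e f k l (gKinv i) = l i := fun i => by simp [freeLift]
  cases r with
  | K_mul_L i => simpa only [map_mul, map_one, hK, hL] using h.K_mul_L i
  | L_mul_K i => simpa only [map_mul, map_one, hK, hL] using h.L_mul_K i
  | K_comm i j => simpa only [map_mul, hK] using h.K_comm i j
  | K_E i j => simpa only [map_mul, map_smul, hK, hE, hL] using h.K_E i j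
  | K_F i j => simpa only [map_mul, map_smul, hK, hF, hL] using h.K_F i j
  | E_F i j =>
    have := h.E_F i j
    split_ifs at this ⊢
    · simpa only [map_mul, map_smul, map_sub, hE, hF, hK, hL] using this
    · simpa only [map_mul, map_zero, map_sub, hE, hF] using this
  | E_comm i j hij => simpa only [map_mul, hE] using h.E_comm i j hij
  | F_comm i j hij => simpa only [map_mul, hF] using h.F_comm i j hij
  | serre_E i j hij =>
    simpa only [map_mul, map_smul, map_sub, map_add, map_zero, hE] using h.serre_E i j hij
  | serre_F i j hij =>
    simpa only [map_mul, map_smul, map_sub, map_add, map_zero, hF] using h.serre_F i j hij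

/-- The universal property of `Uq`. -/
def lift (h : QRel (N - 1) q e f k l) : Uq N q →ₐ[ℂ] A :=
  RingQuot.liftAlgHom ℂ ⟨freeLift e f k l, freeLift_rel h⟩

theorem lift_mk (h : QRel (N - 1) q e f k l) (x) : lift h (mk N q x) = freeLift e f k l x :=
  RingQuot.liftAlgHom_mkAlgHom_apply ℂ _ _ _

@[simp] theorem lift_E (h : QRel (N - 1) q e f k l) (i) : lift h (E i) = e i := by
  rw [E, lift_mk]; simp [freeLift]
@[simp] theorem lift_F (h : QRel (N - 1) q e f k l) (i) : lift h (F i) = f i := by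
  rw [F, lift_mk]; simp [freeLift]
@[simp] theorem lift_K (h : QRel (N - 1) q e f k l) (i) : lift h (K i) = k i := by
  rw [K, lift_mk]; simp [freeLift]
@[simp] theorem lift_L (h : QRel (N - 1) q e f k l) (i) : lift h (Kinv i) = l i := by
  rw [Kinv, lift_mk]; simp [freeLift]

theorem hom_ext {f g : Uq N q →ₐ[ℂ] A} (hE : ∀ i, f (E i) = g (E i)) (hF : ∀ i, f (F i) = g (F i))
    (hK : ∀ i, f (K i) = g (K i)) (hL : ∀ i, f (Kinv i) = g (Kinv i)) : f = g := by
  apply RingQuot.ringQuot_ext'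
  apply FreeAlgebra.hom_ext
  funext x
  cases x with
  | E i => exact hE i
  | F i => exact hF i
  | K i => exact hK i
  | Kinv i => exact hL i

end lift

theorem qrel_counit (n : ℕ) (q : ℝ) :
    QRel n q (A := ℂ) (fun _ => 0) (fun _ => 0) (fun _ => 1) (fun _ => 1) := by
  constructor <;> simp

def counitHom (N : ℕ) (q : ℝ) : Uq N q →ₐ[ℂ] ℂ := lift (qrel_counit (N - 1) q)

theorem q_ne_zero (h : 0 < q) : (q : ℂ) ≠ 0 := by exact_mod_cast h.ne'

def comulHom (N : ℕ) (q : ℝ) [h : Fact (0 < q)] : Uq N q →ₐ[ℂ] Uq N q ⊗[ℂ] Uq N q :=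
  lift ((qrel N q).tensor (q_ne_zero h.out) (qrel N q))

/-- `Δ(E_i) = E_i ⊗ K_i + 1 ⊗ E_i`, `Δ(F_i) = F_i ⊗ 1 + K_i⁻¹ ⊗ F_i`, `Δ(K_i) = K_i ⊗ K_i`,
`ε(E_i) = ε(F_i) = 0`, `ε(K_i) = 1`. -/
instance (N : ℕ) (q : ℝ) [Fact (0 < q)] : Bialgebra ℂ (Uq N q) :=
  Bialgebra.ofAlgHom (comulHom N q) (counitHom N q)
    (by
      apply hom_ext <;> intro i <;>
        simp [comulHom, TensorProduct.add_tmul, TensorProduct.tmul_add,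
          Algebra.TensorProduct.one_def, add_assoc])
    (by
      apply hom_ext <;> intro i <;> simp [comulHom, counitHom])
    (by
      apply hom_ext <;> intro i <;> simp [comulHom, counitHom])

/-- The antipode as a homomorphism to the opposite algebra. -/
def antipodeHom (N : ℕ) (q : ℝ) [h : Fact (0 < q)] : Uq N q →ₐ[ℂ] (Uq N q)ᵐᵒᵖ :=
  lift ((qrel N q).antipode (q_ne_zero h.out))

/-- The antipode: `S(K_i) = K_i⁻¹`, `S(E_i) = -E_i K_i⁻¹`, `S(F_i) = -K_i F_i`. -/
def S (N : ℕ) (q : ℝ) [Fact (0 < q)] : Uq N q →ₗ[ℂ] Uq N q :=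
  (MulOpposite.opLinearEquiv ℂ).symm.toLinearMap ∘ₗ (antipodeHom N q).toLinearMap

/-- The compact real form as a homomorphism to the conjugate opposite algebra. -/
def starHom (N : ℕ) (q : ℝ) [h : Fact (0 < q)] : Uq N q →ₐ[ℂ] ConjOp (Uq N q) :=
  lift ((qrel N q).compact (q_ne_zero h.out))

/-- The compact real form: the conjugate-linear anti-automorphism with
`K_i* = K_i`, `E_i* = K_i F_i`, `F_i* = E_i K_i⁻¹`. -/
def starMap [Fact (0 < q)] (X : Uq N q) : Uq N q := (starHom N q X).un

end Uq

section fund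

/-- `π(E_k) v_i = δ_(i,k+1) q^(-1/2) v_(i-1)`; the basis `v_1, …, v_N` is indexed by `Fin N`, so the
index `i : Fin N` stands for `v_(i+1)`. Entry `(a, b)` of `π(X)` is the coefficient of `v_a` in `X v_b`. -/
def fundE (N : ℕ) (q : ℝ) (k : Fin (N - 1)) : Matrix (Fin N) (Fin N) ℂ :=
  Matrix.single ⟨k, by omega⟩ ⟨k + 1, by omega⟩ ((Real.sqrt q : ℂ)⁻¹)

/-- `π(F_k) v_i = δ_(i,k) q^(1/2) v_(i+1)`. -/
def fundF (N : ℕ) (q : ℝ) (k : Fin (N - 1)) : Matrix (Fin N) (Fin N) ℂ :=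
  Matrix.single ⟨k + 1, by omega⟩ ⟨k, by omega⟩ (Real.sqrt q : ℂ)

/-- The exponent `δ_(i,k) - δ_(i,k+1)`. -/
def fundWeight {N : ℕ} (k : Fin (N - 1)) (i : Fin N) : ℤ :=
  (if (i : ℕ) = k then 1 else 0) - (if (i : ℕ) = k + 1 then 1 else 0)

/-- `π(K_k) v_i = q^(δ_(i,k) - δ_(i,k+1)) v_i`. -/
def fundK (N : ℕ) (q : ℝ) (k : Fin (N - 1)) : Matrix (Fin N) (Fin N) ℂ :=
  Matrix.diagonal fun i => (q : ℂ) ^ fundWeight k i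

/-- `π(K_k⁻¹)`. -/
def fundKinv (N : ℕ) (q : ℝ) (k : Fin (N - 1)) : Matrix (Fin N) (Fin N) ℂ :=
  Matrix.diagonal fun i => (q : ℂ) ^ (-fundWeight k i)

theorem fund_qrel (N : ℕ) (q : ℝ) (hq : 0 < q) (hq1 : q ≠ 1) :
    QRel (N - 1) q (fundE N q) (fundF N q) (fundK N q) (fundKinv N q) := by
  have hq0 : (q : ℂ) ≠ 0 := Uq.q_ne_zero hq
  have hs : (Real.sqrt q : ℂ) ≠ 0 := by exact_mod_cast (Real.sqrt_pos.2 hq).ne'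
  have hqq : (q : ℂ) - (q : ℂ)⁻¹ ≠ 0 := by
    intro h
    have h2 : (q : ℂ) * q = 1 := by
      rw [sub_eq_zero] at h
      nth_rewrite 2 [h]
      exact mul_inv_cancel₀ hq0
    have h3 : q * q = 1 := by exact_mod_cast h2
    have : (q - 1) * (q + 1) = 0 := by linear_combination h3
    rcases mul_eq_zero.1 this with h | h
    · exact hq1 (by linarith)
    · linarith
  have EE : ∀ i j : Fin (N - 1), (i : ℕ) + 1 ≠ j → fundE N q i * fundE N q j = 0 := by
    intro i j h
    rw [fundE, fundE, Matrix.single_mul_single_of_ne]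
    simpa [Fin.ext_iff] using h
  have FF : ∀ i j : Fin (N - 1), (j : ℕ) + 1 ≠ i → fundF N q i * fundF N q j = 0 := by
    intro i j h
    rw [fundF, fundF, Matrix.single_mul_single_of_ne]
    simpa [Fin.ext_iff] using h.symm
  have hA : ∀ i j : Fin (N - 1), CartanMatrix.A (N - 1) i j = if (i : ℕ) = j then 2 else
      if (i : ℕ) + 1 = j ∨ (j : ℕ) + 1 = i then -1 else 0 := by
    intro i j
    simp [CartanMatrix.A, Fin.ext_iff]
  constructor
  · intro i
    rw [fundK, fundKinv, Matrix.diagonal_mul_diagonal, ← Matrix.diagonal_one]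
    congr 1; funext x; rw [← zpow_add₀ hq0]; simp
  · intro i
    rw [fundK, fundKinv, Matrix.diagonal_mul_diagonal, ← Matrix.diagonal_one]
    congr 1; funext x; rw [← zpow_add₀ hq0]; simp
  · intro i j
    simp only [fundK, Matrix.diagonal_mul_diagonal, mul_comm]
  · intro k j
    ext a b
    simp only [fundK, fundKinv, fundE, Matrix.mul_diagonal, Matrix.diagonal_mul, Matrix.smul_apply,
      Matrix.single_apply, smul_eq_mul, Fin.ext_iff]
    split_ifs with h
    · rw [mul_right_comm, ← zpow_add₀ hq0]
      congr 2
      rw [hA, fundWeight, fundWeight, ← h.1, ← h.2]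
      grind
    · simp
  · intro k j
    ext a b
    simp only [fundK, fundKinv, fundF, Matrix.mul_diagonal, Matrix.diagonal_mul, Matrix.smul_apply,
      Matrix.single_apply, smul_eq_mul, Fin.ext_iff]
    split_ifs with h
    · rw [mul_right_comm, ← zpow_add₀ hq0]
      congr 2
      rw [hA, fundWeight, fundWeight, ← h.1, ← h.2]
      grind
    · simp
  · intro i j
    split_ifs with hij
    · subst hij
      rw [fundE, fundF, Matrix.single_mul_single_same, Matrix.single_mul_single_same,
        inv_mul_cancel₀ hs, mul_inv_cancel₀ hs, eq_inv_smul_iff₀ hqq]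
      ext a b
      simp only [fundK, fundKinv, Matrix.sub_apply, Matrix.smul_apply, Matrix.single_apply,
        Matrix.diagonal_apply, smul_eq_mul, Fin.ext_iff, fundWeight]
      by_cases hab : (a : ℕ) = b
      · obtain rfl : a = b := Fin.ext hab
        by_cases h1 : (a : ℕ) = i
        · simp [h1]
        · by_cases h2 : (a : ℕ) = i + 1
          · simp [h2]
          · simp [h1, h2, Ne.symm h1, Ne.symm h2]
      · have : ∀ x : ℕ, ¬ (x = a ∧ x = b) := fun x h => hab (h.1.symm.trans h.2)
        simp [hab, this]
    · have hij' : (i : ℕ) ≠ j := fun h => hij (Fin.ext h)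
      rw [fundE, fundF, Matrix.single_mul_single_of_ne, Matrix.single_mul_single_of_ne, sub_zero]
      · simpa [Fin.ext_iff] using hij'.symm
      · simpa [Fin.ext_iff] using hij'
  · intro i j h
    rw [hA] at h
    rw [EE i j (by grind), EE j i (by grind)]
  · intro i j h
    rw [hA] at h
    rw [FF i j (by grind), FF j i (by grind)]
  · intro i j h
    rw [hA] at h
    have h1 : fundE N q i * fundE N q i = 0 := EE i i (by omega)
    have h2 : fundE N q i * fundE N q j * fundE N q i = 0 := by
      by_cases h3 : (i : ℕ) + 1 = j
      · rw [mul_assoc, EE j i (by omega), mul_zero]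
      · rw [EE i j h3, zero_mul]
    rw [h2, h1, mul_assoc, h1]; simp
  · intro i j h
    rw [hA] at h
    have h1 : fundF N q i * fundF N q i = 0 := FF i i (by omega)
    have h2 : fundF N q i * fundF N q j * fundF N q i = 0 := by
      by_cases h3 : (j : ℕ) + 1 = i
      · rw [mul_assoc, FF j i (by omega), mul_zero]
      · rw [FF i j h3, zero_mul]
    rw [h2, h1, mul_assoc, h1]; simp

/-- The fundamental representation `V(ω_1)` of `U_q(sl(N))` on `ℂ^N`, whose standard basis is
orthonormal for the invariant Hermitian inner product. -/
def fundRep (N : ℕ) (q : ℝ) [h : Fact (0 < q)] [h1 : Fact (q ≠ 1)] :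
    Uq N q →ₐ[ℂ] Matrix (Fin N) (Fin N) ℂ :=
  Uq.lift (fund_qrel N q h.out h1.out)

end fund

namespace Uq
variable {N : ℕ} {q : ℝ}

/-- `K_i` as a unit. -/
def kUnit (i : Fin (N - 1)) : (Uq N q)ˣ :=
  ⟨K i, Kinv i, (qrel N q).K_mul_L i, (qrel N q).L_mul_K i⟩

/-- `K_λ = K_1^(n_1) ⋯ K_(N-1)^(n_(N-1))` for `λ = ∑ n_i α_i`. -/
def kLam (N : ℕ) (q : ℝ) (lam : Fin (N - 1) → ℤ) : (Uq N q)ˣ :=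
  ((List.finRange (N - 1)).map fun i => kUnit i ^ lam i).prod

/-- The sum of the positive roots, `2ρ = ∑_k k (N - k) α_k`, with `k = i + 1`. -/
def twoRho (N : ℕ) (i : Fin (N - 1)) : ℤ := ((i : ℤ) + 1) * ((N : ℤ) - ((i : ℤ) + 1))

theorem kLam_single (i : Fin (N - 1)) (m : ℤ) :
    kLam N q (Pi.single i m) = kUnit i ^ m := by
  rw [kLam, List.prod_map_eq_pow_single i _ (fun j hj _ => by simp [hj]),
    List.count_eq_one_of_mem (List.nodup_finRange _) (List.mem_finRange i)]
  simp

variable [Fact (0 < q)]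

theorem comul_E (i : Fin (N - 1)) : Coalgebra.comul (R := ℂ) (E i : Uq N q) =
    E i ⊗ₜ[ℂ] K i + 1 ⊗ₜ[ℂ] E i := lift_E _ _
theorem comul_F (i : Fin (N - 1)) : Coalgebra.comul (R := ℂ) (F i : Uq N q) =
    F i ⊗ₜ[ℂ] 1 + Kinv i ⊗ₜ[ℂ] F i := lift_F _ _
theorem comul_K (i : Fin (N - 1)) : Coalgebra.comul (R := ℂ) (K i : Uq N q) =
    K i ⊗ₜ[ℂ] K i := lift_K _ _
theorem comul_L (i : Fin (N - 1)) : Coalgebra.comul (R := ℂ) (Kinv i : Uq N q) =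
    Kinv i ⊗ₜ[ℂ] Kinv i := lift_L _ _
theorem counit_E (i : Fin (N - 1)) : Coalgebra.counit (R := ℂ) (E i : Uq N q) = 0 := lift_E _ _
theorem counit_F (i : Fin (N - 1)) : Coalgebra.counit (R := ℂ) (F i : Uq N q) = 0 := lift_F _ _
theorem counit_K (i : Fin (N - 1)) : Coalgebra.counit (R := ℂ) (K i : Uq N q) = 1 := lift_K _ _
theorem counit_L (i : Fin (N - 1)) : Coalgebra.counit (R := ℂ) (Kinv i : Uq N q) = 1 := lift_L _ _

theorem comul_kLam (lam : Fin (N - 1) → ℤ) :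
    Coalgebra.comul (R := ℂ) (kLam N q lam : Uq N q) =
      (kLam N q lam : Uq N q) ⊗ₜ[ℂ] (kLam N q lam : Uq N q) := by
  let H : Subgroup (Uq N q)ˣ :=
    { carrier := {u | Coalgebra.comul (R := ℂ) (u : Uq N q) = (u : Uq N q) ⊗ₜ[ℂ] (u : Uq N q)}
      one_mem' := by simp [Algebra.TensorProduct.one_def]
      mul_mem' := by
        intro a b ha hb
        simp only [Set.mem_ofPred_eq] at ha hb ⊢
        rw [Units.val_mul, Bialgebra.comul_mul, ha, hb, Algebra.TensorProduct.tmul_mul_tmul]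
      inv_mem' := by
        intro a ha
        simp only [Set.mem_ofPred_eq] at ha ⊢
        have h1 : Coalgebra.comul (R := ℂ) ((a⁻¹ : (Uq N q)ˣ) : Uq N q) *
            Coalgebra.comul (R := ℂ) (a : Uq N q) = 1 := by
          rw [← Bialgebra.comul_mul, Units.inv_mul, Bialgebra.comul_one]
        have h2 : Coalgebra.comul (R := ℂ) (a : Uq N q) *
            (((a⁻¹ : (Uq N q)ˣ) : Uq N q) ⊗ₜ[ℂ] ((a⁻¹ : (Uq N q)ˣ) : Uq N q)) = 1 := by
          rw [ha, Algebra.TensorProduct.tmul_mul_tmul, Units.mul_inv, Algebra.TensorProduct.one_def]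
        exact left_inv_eq_right_inv h1 h2 }
  change kLam N q lam ∈ H
  apply Subgroup.list_prod_mem
  intro x hx
  obtain ⟨i, -, rfl⟩ := List.mem_map.1 hx
  exact Subgroup.zpow_mem _ (comul_K i) _

theorem counit_kLam (lam : Fin (N - 1) → ℤ) :
    Coalgebra.counit (R := ℂ) (kLam N q lam : Uq N q) = 1 := by
  have : kLam N q lam ∈ (Units.map ((Bialgebra.counitAlgHom ℂ (Uq N q) : _ →* ℂ))).ker := by
    apply Subgroup.list_prod_mem
    intro x hx
    obtain ⟨i, -, rfl⟩ := List.mem_map.1 hx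
    refine Subgroup.zpow_mem _ ?_ _
    rw [MonoidHom.mem_ker]
    ext
    exact counit_K i
  rw [MonoidHom.mem_ker] at this
  exact congrArg Units.val this

/-- The quantized Levi factor `U_q(l_T)`: the subalgebra generated by all `K_λ` and by `E_i, F_i`,
`i ∈ T`. -/
def levi (N : ℕ) (q : ℝ) (T : Set (Fin (N - 1))) : Subalgebra ℂ (Uq N q) :=
  Algebra.adjoin ℂ
    (Set.range (fun lam => (kLam N q lam : Uq N q)) ∪ (E '' T ∪ F '' T))

end Uq

section dual

/-- The linear dual of `U_q(sl(N))`, with the convolution product `(φ ψ)(X) = (φ ⊗ ψ)(Δ X)` and unit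
`ε`. -/
abbrev UqDual (N : ℕ) (q : ℝ) : Type := WithConv (Uq N q →ₗ[ℂ] ℂ)

variable {N : ℕ} {q : ℝ} [Fact (0 < q)]


/-- `(X ▷ φ)(Y) = φ(Y X)`. -/
def leftAct (X : Uq N q) (φ : UqDual N q) : UqDual N q :=
  WithConv.toConv (φ.ofConv ∘ₗ LinearMap.mulRight ℂ X)

/-- `(φ ◁ X)(Y) = φ(X Y)`. -/
def rightAct (φ : UqDual N q) (X : Uq N q) : UqDual N q :=
  WithConv.toConv (φ.ofConv ∘ₗ LinearMap.mulLeft ℂ X)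

/-- `φ*(X) = conj (φ(S(X)*))`. -/
def dualStar (φ : UqDual N q) : UqDual N q :=
  WithConv.toConv
    { toFun := fun X => starRingEnd ℂ (φ (Uq.starMap (Uq.S N q X)))
      map_add' := by
        intro X Y
        have : Uq.starMap (Uq.S N q (X + Y)) =
            Uq.starMap (Uq.S N q X) + Uq.starMap (Uq.S N q Y) := by
          simp only [map_add, Uq.starMap]; rfl
        rw [this, map_add, map_add]
      map_smul' := by
        intro c X
        have : Uq.starMap (Uq.S N q (c • X)) = starRingEnd ℂ c • Uq.starMap (Uq.S N q X) := by
          simp only [map_smul, Uq.starMap]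
          have := ConjOp.mk_smul c (Uq.starMap (Uq.S N q X))
          exact (congrArg ConjOp.un this).symm
        rw [this]
        simp }

/-- A finite-dimensional representation of type 1, i.e. a direct sum of the `V(Λ)`: each `K_k` acts
diagonalizably with eigenvalues integer powers of `q`. -/
def IsTypeOne {n : ℕ} (π : Uq N q →ₐ[ℂ] Matrix (Fin n) (Fin n) ℂ) : Prop :=
  ∀ k : Fin (N - 1), ∃ (B C : Matrix (Fin n) (Fin n) ℂ) (d : Fin n → ℤ),
    B * C = 1 ∧ π (Uq.K k) = B * Matrix.diagonal (fun i => (q : ℂ) ^ d i) * C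

/-- The matrix coefficient `X ↦ π(X)^i_j`. -/
def matrixCoeff {n : ℕ} (π : Uq N q →ₐ[ℂ] Matrix (Fin n) (Fin n) ℂ) (i j : Fin n) :
    UqDual N q :=
  WithConv.toConv (Matrix.entryLinearMap ℂ ℂ i j ∘ₗ π.toLinearMap)

/-- The span of the matrix coefficients of finite-dimensional (type 1) representations. -/
def coeffSpan (N : ℕ) (q : ℝ) : Submodule ℂ (UqDual N q) :=
  Submodule.span ℂ {φ | ∃ (n : ℕ) (π : Uq N q →ₐ[ℂ] Matrix (Fin n) (Fin n) ℂ) (i j : Fin n),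
    IsTypeOne π ∧ φ = matrixCoeff π i j}

theorem one_mem_coeffSpan : (1 : UqDual N q) ∈ coeffSpan N q := by
  apply Submodule.subset_span
  refine ⟨1, (Algebra.ofId ℂ (Matrix (Fin 1) (Fin 1) ℂ)).comp (Uq.counitHom N q), 0, 0, ?_, ?_⟩
  · intro k
    refine ⟨1, 1, fun _ => 0, by simp, ?_⟩
    simp [Uq.counitHom]
  · ext X
    simp [matrixCoeff, Algebra.ofId_apply, Matrix.algebraMap_matrix_apply]
    rfl

/-- The tensor product of two matrix representations. -/
def tensorRep {m n : ℕ} (π : Uq N q →ₐ[ℂ] Matrix (Fin m) (Fin m) ℂ)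
    (π' : Uq N q →ₐ[ℂ] Matrix (Fin n) (Fin n) ℂ) :
    Uq N q →ₐ[ℂ] Matrix (Fin (m * n)) (Fin (m * n)) ℂ :=
  ((Matrix.reindexAlgEquiv ℂ ℂ finProdFinEquiv).toAlgHom.comp
    (Matrix.kroneckerAlgEquiv (Fin m) (Fin n) ℂ).toAlgHom).comp
      ((Algebra.TensorProduct.map π π').comp (Bialgebra.comulAlgHom ℂ (Uq N q)))

theorem tensorRep_coeff {m n : ℕ} (π : Uq N q →ₐ[ℂ] Matrix (Fin m) (Fin m) ℂ)
    (π' : Uq N q →ₐ[ℂ] Matrix (Fin n) (Fin n) ℂ) (i j : Fin m) (k l : Fin n) :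
    matrixCoeff π i j * matrixCoeff π' k l =
      matrixCoeff (tensorRep π π') (finProdFinEquiv (i, k)) (finProdFinEquiv (j, l)) := by
  ext X
  rw [LinearMap.convMul_def]
  simp only [matrixCoeff, tensorRep, LinearMap.comp_apply, AlgHom.toLinearMap_apply,
    AlgHom.comp_apply, Bialgebra.comulAlgHom_apply]
  generalize Coalgebra.comul (R := ℂ) X = Z
  induction Z using TensorProduct.induction_on with
  | zero => simp
  | add x y hx hy =>
    simp only [map_add, hx, hy]
  | tmul a b => simp [kroneckerLinearEquiv_tmul, mul_comm]

theorem IsTypeOne.tensor {m n : ℕ} {π : Uq N q →ₐ[ℂ] Matrix (Fin m) (Fin m) ℂ}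
    {π' : Uq N q →ₐ[ℂ] Matrix (Fin n) (Fin n) ℂ} (h : IsTypeOne π) (h' : IsTypeOne π') :
    IsTypeOne (tensorRep π π') := by
  intro k
  obtain ⟨B, C, d, hBC, hK⟩ := h k
  obtain ⟨B', C', d', hBC', hK'⟩ := h' k
  let R := Matrix.reindexAlgEquiv ℂ ℂ (finProdFinEquiv (m := m) (n := n))
  refine ⟨R (Matrix.kroneckerMap (· * ·) B B'), R (Matrix.kroneckerMap (· * ·) C C'),
    fun x => d (finProdFinEquiv.symm x).1 + d' (finProdFinEquiv.symm x).2, ?_, ?_⟩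
  · rw [← map_mul, ← Matrix.mul_kronecker_mul, hBC, hBC', Matrix.one_kronecker_one, map_one]
  · have h1 : tensorRep π π' (Uq.K k) = R (Matrix.kroneckerMap (· * ·) (π (Uq.K k)) (π' (Uq.K k))) := by
      simp only [tensorRep, AlgHom.comp_apply, Bialgebra.comulAlgHom_apply, Uq.comul_K,
        Algebra.TensorProduct.map_tmul]
      rfl
    have h2 : Matrix.diagonal (fun x => (q : ℂ) ^ (d (finProdFinEquiv.symm x).1 +
        d' (finProdFinEquiv.symm x).2)) = R (Matrix.kroneckerMap (· * ·)
          (Matrix.diagonal fun i => (q : ℂ) ^ d i) (Matrix.diagonal fun i => (q : ℂ) ^ d' i)) := by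
      rw [Matrix.diagonal_kronecker_diagonal, Matrix.coe_reindexAlgEquiv, Matrix.reindex_apply,
        Matrix.submatrix_diagonal_equiv]
      congr 1
      funext x
      simp [zpow_add₀ (Uq.q_ne_zero (Fact.out : 0 < q))]
    rw [h1, h2, hK, hK', Matrix.mul_kronecker_mul, Matrix.mul_kronecker_mul, map_mul, map_mul]

/-- The quantized coordinate ring `ℂ_q[SL(N)]`, as a subalgebra of the dual of `U_q(sl(N))`. -/
def Cq (N : ℕ) (q : ℝ) [Fact (0 < q)] : Subalgebra ℂ (UqDual N q) :=
  (coeffSpan N q).toSubalgebra one_mem_coeffSpan (by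
    intro x y hx hy
    induction hx using Submodule.span_induction with
    | zero => simp
    | add a b _ _ ha hb => rw [add_mul]; exact Submodule.add_mem _ ha hb
    | smul c a _ ha => rw [smul_mul_assoc]; exact Submodule.smul_mem _ _ ha
    | mem a ha =>
      obtain ⟨m, π, i, j, hπ, rfl⟩ := ha
      induction hy using Submodule.span_induction with
      | zero => simp
      | add a b _ _ ha hb => rw [mul_add]; exact Submodule.add_mem _ ha hb
      | smul c a _ ha => rw [mul_smul_comm]; exact Submodule.smul_mem _ _ ha
      | mem b hb =>
        obtain ⟨n, π', k, l, hπ', rfl⟩ := hb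
        rw [tensorRep_coeff]
        exact Submodule.subset_span ⟨_, _, _, _, hπ.tensor hπ', rfl⟩)

theorem leftAct_mem (X : Uq N q) {φ : UqDual N q} (h : φ ∈ Cq N q) : leftAct X φ ∈ Cq N q := by
  change φ ∈ coeffSpan N q at h
  change _ ∈ coeffSpan N q
  induction h using Submodule.span_induction with
  | zero => 
    have : leftAct X (0 : UqDual N q) = 0 := by ext; simp [leftAct]
    rw [this]; simp
  | add a b _ _ ha hb => 
    have : leftAct X (a + b) = leftAct X a + leftAct X b := by ext; simp [leftAct]
    rw [this]; exact Submodule.add_mem _ ha hb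
  | smul c a _ ha =>
    have : leftAct X (c • a) = c • leftAct X a := by ext; simp [leftAct]
    rw [this]; exact Submodule.smul_mem _ _ ha
  | mem a ha =>
    obtain ⟨m, π, i, j, hπ, rfl⟩ := ha
    have : leftAct X (matrixCoeff π i j) = ∑ k, π X k j • matrixCoeff π i k := by
      ext Y
      simp [leftAct, matrixCoeff, Matrix.mul_apply, mul_comm]
    rw [this]
    exact Submodule.sum_mem _ fun k _ => Submodule.smul_mem _ _
      (Submodule.subset_span ⟨_, _, _, _, hπ, rfl⟩)

theorem mul_apply' (φ ψ : UqDual N q) (X : Uq N q) : (φ * ψ) X =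
    LinearMap.mul' ℂ ℂ (TensorProduct.map φ.ofConv ψ.ofConv (Coalgebra.comul (R := ℂ) X)) := rfl

theorem rightAct_mul {a b : UqDual N q} {X x y x' y' : Uq N q}
    (h : Coalgebra.comul (R := ℂ) X = x ⊗ₜ[ℂ] y + x' ⊗ₜ[ℂ] y') :
    rightAct (a * b) X = rightAct a x * rightAct b y + rightAct a x' * rightAct b y' := by
  ext Y
  change (a * b) (X * Y) = (rightAct a x * rightAct b y) Y + (rightAct a x' * rightAct b y') Y
  rw [mul_apply', mul_apply', mul_apply', Bialgebra.comul_mul, h]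
  generalize Coalgebra.comul (R := ℂ) Y = Z
  induction Z using TensorProduct.induction_on with
  | zero => simp
  | add z w hz hw =>
    rw [mul_add, map_add, map_add, hz, hw]
    simp only [map_add]
    ring
  | tmul z w => simp [add_mul, rightAct]

/-- The quantized coordinate ring of the generalized flag manifold,
`ℂ_q[L_T \ G] = {a ∈ ℂ_q[G] : a ◁ X = ε(X) a for all X ∈ U_q(l_T)}`. -/
def flag (N : ℕ) (q : ℝ) [Fact (0 < q)] (T : Set (Fin (N - 1))) : Subalgebra ℂ (UqDual N q) where
  carrier := {a | a ∈ Cq N q ∧ ∀ X ∈ Uq.levi N q T,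
    rightAct a X = Coalgebra.counit (R := ℂ) X • a}
  add_mem' := by
    rintro a b ⟨ha, ha'⟩ ⟨hb, hb'⟩
    refine ⟨add_mem ha hb, fun X hX => ?_⟩
    have : rightAct (a + b) X = rightAct a X + rightAct b X := by ext; simp [rightAct]
    rw [this, ha' X hX, hb' X hX, smul_add]
  algebraMap_mem' := by
    intro c
    refine ⟨Subalgebra.algebraMap_mem _ c, fun X hX => ?_⟩
    ext Y
    simp [rightAct]
    ring
  mul_mem' := by
    rintro a b ⟨ha, ha'⟩ ⟨hb, hb'⟩
    refine ⟨mul_mem ha hb, fun X hX => ?_⟩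
    have hsub : ∀ {x}, x ∈ Set.range (fun lam => (Uq.kLam N q lam : Uq N q)) ∪
        (Uq.E '' T ∪ Uq.F '' T) → x ∈ Uq.levi N q T := fun h => Algebra.subset_adjoin h
    have hK : ∀ i, (Uq.K i : Uq N q) ∈ Uq.levi N q T := fun i => hsub (Or.inl
      ⟨Pi.single i 1, by dsimp only; rw [Uq.kLam_single, zpow_one]; rfl⟩)
    have hL : ∀ i, (Uq.Kinv i : Uq N q) ∈ Uq.levi N q T := fun i => hsub (Or.inl
      ⟨Pi.single i (-1), by dsimp only; rw [Uq.kLam_single, zpow_neg_one]; rfl⟩)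
    have a1 := ha' 1 (one_mem _)
    have b1 := hb' 1 (one_mem _)
    rw [Bialgebra.counit_one, one_smul] at a1 b1
    induction hX using Algebra.adjoin_induction with
    | mem x hx =>
      rcases hx with hx | hx | hx
      · have hx' := hsub (Or.inl hx)
        obtain ⟨lam, rfl⟩ := hx
        dsimp only at hx' ⊢
        rw [rightAct_mul (x := (Uq.kLam N q lam : Uq N q))
          (y := (Uq.kLam N q lam : Uq N q)) (x' := 0) (y' := 0) (by rw [Uq.comul_kLam, TensorProduct.tmul_zero,
          add_zero]), ha' _ hx', hb' _ hx']
        have : rightAct a 0 = 0 := by ext; simp [rightAct]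
        rw [this]
        simp [Uq.counit_kLam]
      · have hx' := hsub (Or.inr (Or.inl hx))
        obtain ⟨i, -, rfl⟩ := hx
        rw [rightAct_mul (Uq.comul_E i), ha' _ hx', hb' _ hx']
        simp [Uq.counit_E]
      · have hx' := hsub (Or.inr (Or.inr hx))
        obtain ⟨i, -, rfl⟩ := hx
        rw [rightAct_mul (Uq.comul_F i), ha' _ hx', hb' _ hx']
        simp [Uq.counit_F]
    | algebraMap r =>
      have : rightAct (a * b) (algebraMap ℂ (Uq N q) r) = r • (a * b) := by
        ext Y
        change (a * b) (algebraMap ℂ (Uq N q) r * Y) = r * (a * b) Y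
        rw [← Algebra.smul_def, map_smul, smul_eq_mul]
      rw [this, Bialgebra.counit_algebraMap]
    | add x y _ _ hx hy =>
      have : rightAct (a * b) (x + y) = rightAct (a * b) x + rightAct (a * b) y := by
        ext; simp [rightAct, add_mul]
      rw [this, hx, hy, map_add, add_smul]
    | mul x y _ _ hx hy =>
      have : rightAct (a * b) (x * y) = rightAct (rightAct (a * b) x) y := by
        ext; simp [rightAct, mul_assoc]
      have h2 : ∀ (c : ℂ) (z : UqDual N q), rightAct (c • z) y = c • rightAct z y := by
        intros; ext; simp [rightAct]
      rw [this, hx, h2, hy, smul_smul, Bialgebra.counit_mul]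


theorem Uq.kLam_mem_levi (T : Set (Fin (N - 1))) (lam : Fin (N - 1) → ℤ) :
    (Uq.kLam N q lam : Uq N q) ∈ Uq.levi N q T :=
  Algebra.subset_adjoin (Or.inl ⟨lam, rfl⟩)

/-- The modular automorphism of the Haar state, `θ(a) = K_(2ρ) ▷ a ◁ K_(2ρ)`. -/
def modular (N : ℕ) (q : ℝ) [Fact (0 < q)] : UqDual N q →ₐ[ℂ] UqDual N q where
  toFun a := leftAct (Uq.kLam N q (Uq.twoRho N)) (rightAct a (Uq.kLam N q (Uq.twoRho N)))
  map_one' := by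
    ext X
    simp [leftAct, rightAct, Bialgebra.counit_mul, Uq.counit_kLam]
  map_mul' a b := by
    ext X
    change (a * b) (Uq.kLam N q (Uq.twoRho N) * (X * Uq.kLam N q (Uq.twoRho N))) = _
    rw [LinearMap.convMul_apply, Bialgebra.comul_mul, Bialgebra.comul_mul, Uq.comul_kLam]
    change _ = LinearMap.mul' ℂ ℂ (TensorProduct.map _ _ (Coalgebra.comul (R := ℂ) X))
    generalize Coalgebra.comul (R := ℂ) X = Z
    induction Z using TensorProduct.induction_on with
    | zero => simp
    | add z w hz hw =>
      rw [add_mul, mul_add, map_add, map_add, hz, hw, map_add, map_add]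
    | tmul z w => simp [rightAct, leftAct]
  map_zero' := by ext; simp [leftAct, rightAct]
  map_add' a b := by ext; simp [leftAct, rightAct]
  commutes' c := by
    ext X
    simp [leftAct, rightAct, Bialgebra.counit_mul, Uq.counit_kLam]

theorem modular_mem (T : Set (Fin (N - 1))) {a : UqDual N q} (ha : a ∈ flag N q T) :
    modular N q a ∈ flag N q T := by
  have h1 : modular N q a = leftAct (Uq.kLam N q (Uq.twoRho N)) a := by
    change leftAct _ (rightAct a _) = _
    rw [ha.2 _ (Uq.kLam_mem_levi T _), Uq.counit_kLam, one_smul]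
  rw [h1]
  refine ⟨leftAct_mem _ ha.1, fun X hX => ?_⟩
  have h2 : rightAct (leftAct (Uq.kLam N q (Uq.twoRho N)) a) X =
      leftAct (Uq.kLam N q (Uq.twoRho N)) (rightAct a X) := by
    ext; simp [leftAct, rightAct, mul_assoc]
  rw [h2, ha.2 X hX]
  ext; simp [leftAct]

/-- The restriction of `θ` to `ℂ_q[L_T \ G]`. -/
def modularFlag (N : ℕ) (q : ℝ) [Fact (0 < q)] (T : Set (Fin (N - 1))) :
    flag N q T →ₐ[ℂ] flag N q T :=
  ((modular N q).comp (flag N q T).val).codRestrict (flag N q T) fun a => modular_mem T a.2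

/-- The quantum Grassmannian `ℂ_q[Gr(r, N)]`: all simple roots except `α_r` belong to the Levi
factor. It is the subalgebra `flag N q {k | k + 1 ≠ r}` regarded as an algebra of its own. -/
def Gr (r N : ℕ) (q : ℝ) [Fact (0 < q)] : Type := ↥(flag N q {k | (k : ℕ) + 1 ≠ r})

instance (r N : ℕ) (q : ℝ) [Fact (0 < q)] : Ring (Gr r N q) :=
  inferInstanceAs (Ring ↥(flag N q {k | (k : ℕ) + 1 ≠ r}))

instance (r N : ℕ) (q : ℝ) [Fact (0 < q)] : Algebra ℂ (Gr r N q) :=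
  inferInstanceAs (Algebra ℂ ↥(flag N q {k | (k : ℕ) + 1 ≠ r}))

/-- The inclusion of `ℂ_q[Gr(r, N)]` in the dual of `U_q(sl(N))`. -/
def Gr.incl (r N : ℕ) (q : ℝ) [Fact (0 < q)] : Gr r N q →ₐ[ℂ] UqDual N q :=
  (flag N q {k | (k : ℕ) + 1 ≠ r}).val

/-- The twist on `ℂ_q[Gr(r, N)]`: the restriction of the modular automorphism. -/
def grModular (r N : ℕ) (q : ℝ) [Fact (0 < q)] : Gr r N q →ₐ[ℂ] Gr r N q :=
  modularFlag N q {k | (k : ℕ) + 1 ≠ r}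

/-- The generators `u^i_j`. -/
def u (N : ℕ) (q : ℝ) [Fact (0 < q)] [Fact (q ≠ 1)] (i j : Fin N) : UqDual N q :=
  matrixCoeff (fundRep N q) i j

/-- The matrix units, `(M^n_m)^i_j = (u^m_i)* u^n_j`. -/
def unitM (N : ℕ) (q : ℝ) [Fact (0 < q)] [Fact (q ≠ 1)] (m n : Fin N) :
    Matrix (Fin N) (Fin N) (UqDual N q) :=
  Matrix.of fun i j => dualStar (u N q m i) * u N q n j

/-- `P = ∑_(m ≤ r) M^m_m`. -/
def projP (r N : ℕ) (q : ℝ) [Fact (0 < q)] [Fact (q ≠ 1)] :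
    Matrix (Fin N) (Fin N) (UqDual N q) :=
  ∑ m ∈ Finset.univ.filter (fun m : Fin N => (m : ℕ) < r), unitM N q m m

/-- The action of `U_q(sl(N))` on `V(ω_1) = ℂ^N`. -/
def vAct (N : ℕ) (q : ℝ) [Fact (0 < q)] [Fact (q ≠ 1)] :
    Uq N q →ₗ[ℂ] ((Fin N → ℂ) →ₗ[ℂ] (Fin N → ℂ)) :=
  Matrix.toLin'.toLinearMap ∘ₗ (fundRep N q).toLinearMap

/-- The action on the dual, `(X ▷ f)(v) = f(S(X) ▷ v)`. -/
def dualVAct (N : ℕ) (q : ℝ) [Fact (0 < q)] [Fact (q ≠ 1)] :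
    Uq N q →ₗ[ℂ] (Module.Dual ℂ (Fin N → ℂ) →ₗ[ℂ] Module.Dual ℂ (Fin N → ℂ)) :=
  Module.Dual.transpose ∘ₗ vAct N q ∘ₗ Uq.S N q

/-- The action on `V(ω_1) ⊗ V(ω_1)*`, `X ▷ (v ⊗ f) = X_(1) ▷ v ⊗ X_(2) ▷ f`. -/
def tensorAct (N : ℕ) (q : ℝ) [Fact (0 < q)] [Fact (q ≠ 1)] (X : Uq N q) :
    ((Fin N → ℂ) ⊗[ℂ] Module.Dual ℂ (Fin N → ℂ)) →ₗ[ℂ]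
      ((Fin N → ℂ) ⊗[ℂ] Module.Dual ℂ (Fin N → ℂ)) :=
  TensorProduct.homTensorHomMap (.id ℂ) _ _ _ _
    (TensorProduct.map (vAct N q) (dualVAct N q) (Coalgebra.comul (R := ℂ) X))

/-- `w = ∑_(m ≤ r) v_m ⊗ f^m`, where `f^m` is the dual basis. -/
def invVec (r N : ℕ) : (Fin N → ℂ) ⊗[ℂ] Module.Dual ℂ (Fin N → ℂ) :=
  ∑ m ∈ Finset.univ.filter (fun m : Fin N => (m : ℕ) < r), (Pi.single m 1 : Fin N → ℂ) ⊗ₜ[ℂ] LinearMap.proj m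

/-- The matrix `π(K_(2ρ)⁻¹)`. -/
def rhoInv (N : ℕ) (q : ℝ) [Fact (0 < q)] [Fact (q ≠ 1)] : Matrix (Fin N) (Fin N) ℂ :=
  fundRep N q (((Uq.kLam N q (Uq.twoRho N))⁻¹ : (Uq N q)ˣ) : Uq N q)

/-- The `q`-integer `[r]_q`. -/
def qInt (q : ℝ) (r : ℕ) : ℝ := (q ^ r - q⁻¹ ^ r) / (q - q⁻¹)

end dual

section hochschild
variable {A : Type} [Ring A] [Algebra ℂ A]

/-- `m ⊗ a ↦ σ(a) m`, the left action on the twisted bimodule `_σ A`. -/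
def twistMul (σ : A →ₐ[ℂ] A) : A ⊗[ℂ] A →ₗ[ℂ] A :=
  LinearMap.mul' ℂ A ∘ₗ LinearMap.rTensor A σ.toLinearMap ∘ₗ (TensorProduct.comm ℂ A A).toLinearMap

/-- The twisted Hochschild boundary `b_σ : C_2(A, _σ A) → C_1(A, _σ A)`; its value on pure tensors
is given in `hochB2_tmul`. -/
def hochB2 (σ : A →ₐ[ℂ] A) : A ⊗[ℂ] (A ⊗[ℂ] A) →ₗ[ℂ] A ⊗[ℂ] A :=
  LinearMap.rTensor A (LinearMap.mul' ℂ A) ∘ₗ (TensorProduct.assoc ℂ A A A).symm.toLinearMap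
  - LinearMap.lTensor A (LinearMap.mul' ℂ A)
  + LinearMap.rTensor A (twistMul σ) ∘ₗ (TensorProduct.assoc ℂ A A A).symm.toLinearMap
    ∘ₗ LinearMap.lTensor A (TensorProduct.comm ℂ A A).toLinearMap

theorem hochB2_tmul (σ : A →ₐ[ℂ] A) (m a b : A) :
    hochB2 σ (m ⊗ₜ[ℂ] (a ⊗ₜ[ℂ] b)) =
      (m * a) ⊗ₜ[ℂ] b - m ⊗ₜ[ℂ] (a * b) + (σ b * m) ⊗ₜ[ℂ] a := by
  simp [hochB2, twistMul]

/-- The twisted Hochschild boundary `b_σ : C_3(A, _σ A) → C_2(A, _σ A)`; its value on pure tensors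
is given in `hochB3_tmul`. -/
def hochB3 (σ : A →ₐ[ℂ] A) : A ⊗[ℂ] (A ⊗[ℂ] (A ⊗[ℂ] A)) →ₗ[ℂ] A ⊗[ℂ] (A ⊗[ℂ] A) :=
  LinearMap.rTensor (A ⊗[ℂ] A) (LinearMap.mul' ℂ A) ∘ₗ
    (TensorProduct.assoc ℂ A A (A ⊗[ℂ] A)).symm.toLinearMap
  - LinearMap.lTensor A (LinearMap.rTensor A (LinearMap.mul' ℂ A) ∘ₗ
    (TensorProduct.assoc ℂ A A A).symm.toLinearMap)
  + LinearMap.lTensor A (LinearMap.lTensor A (LinearMap.mul' ℂ A))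
  - LinearMap.rTensor (A ⊗[ℂ] A) (twistMul σ) ∘ₗ
    (TensorProduct.assoc ℂ A A (A ⊗[ℂ] A)).symm.toLinearMap ∘ₗ
    LinearMap.lTensor A ((TensorProduct.comm ℂ (A ⊗[ℂ] A) A).toLinearMap ∘ₗ
      (TensorProduct.assoc ℂ A A A).symm.toLinearMap)

theorem hochB3_tmul (σ : A →ₐ[ℂ] A) (m a b c : A) :
    hochB3 σ (m ⊗ₜ[ℂ] (a ⊗ₜ[ℂ] (b ⊗ₜ[ℂ] c))) =
      (m * a) ⊗ₜ[ℂ] (b ⊗ₜ[ℂ] c) - m ⊗ₜ[ℂ] ((a * b) ⊗ₜ[ℂ] c) + m ⊗ₜ[ℂ] (a ⊗ₜ[ℂ] (b * c))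
        - (σ c * m) ⊗ₜ[ℂ] (a ⊗ₜ[ℂ] b) := by
  simp [hochB3, twistMul]

/-- The homology `ker g / im f` of `X → Y → Z` at `Y`. -/
abbrev HomologyAt {X Y Z : Type} [AddCommGroup X] [AddCommGroup Y] [AddCommGroup Z] [Module ℂ X]
    [Module ℂ Y] [Module ℂ Z] (f : X →ₗ[ℂ] Y) (g : Y →ₗ[ℂ] Z) : Type :=
  LinearMap.ker g ⧸ (LinearMap.range f).submoduleOf (LinearMap.ker g)

/-- The class of a cycle. -/
def HomologyAt.mk {X Y Z : Type} [AddCommGroup X] [AddCommGroup Y] [AddCommGroup Z] [Module ℂ X]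
    [Module ℂ Y] [Module ℂ Z] (f : X →ₗ[ℂ] Y) (g : Y →ₗ[ℂ] Z) (y : Y) (hy : g y = 0) :
    HomologyAt f g :=
  Submodule.Quotient.mk ⟨y, hy⟩

/-- The map induced on homology by a morphism of complexes. -/
def HomologyAt.map {X Y Z X' Y' Z' : Type} [AddCommGroup X] [AddCommGroup Y] [AddCommGroup Z]
    [Module ℂ X] [Module ℂ Y] [Module ℂ Z] [AddCommGroup X'] [AddCommGroup Y'] [AddCommGroup Z']
    [Module ℂ X'] [Module ℂ Y'] [Module ℂ Z'] (f : X →ₗ[ℂ] Y) (g : Y →ₗ[ℂ] Z)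
    (f' : X' →ₗ[ℂ] Y') (g' : Y' →ₗ[ℂ] Z') (φX : X →ₗ[ℂ] X') (φY : Y →ₗ[ℂ] Y') (φZ : Z →ₗ[ℂ] Z')
    (hf : ∀ x, φY (f x) = f' (φX x)) (hg : ∀ y, φZ (g y) = g' (φY y)) :
    HomologyAt f g →ₗ[ℂ] HomologyAt f' g' :=
  Submodule.mapQ ((LinearMap.range f).submoduleOf (LinearMap.ker g))
    ((LinearMap.range f').submoduleOf (LinearMap.ker g'))
    (φY.restrict (p := LinearMap.ker g) (q := LinearMap.ker g') (fun y hy => by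
      rw [LinearMap.mem_ker] at hy ⊢
      rw [← hg, hy, map_zero]))
    (by
      rintro ⟨y, hy⟩ ⟨x, hx⟩
      refine ⟨φX x, ?_⟩
      have hx' : f x = y := hx
      change f' (φX x) = φY y
      rw [← hf, hx'])

/-- The twisted Hochschild homology `HH_2^σ(A) = H_2(A, _σ A)`. -/
def HH2 (σ : A →ₐ[ℂ] A) : Type := HomologyAt (hochB3 σ) (hochB2 σ)

instance (σ : A →ₐ[ℂ] A) : AddCommGroup (HH2 σ) :=
  inferInstanceAs (AddCommGroup (HomologyAt (hochB3 σ) (hochB2 σ)))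

instance (σ : A →ₐ[ℂ] A) : Module ℂ (HH2 σ) :=
  inferInstanceAs (Module ℂ (HomologyAt (hochB3 σ) (hochB2 σ)))

/-- The degenerate 1-chains; `C_1 / degen1 = A ⊗ (A / ℂ)`. -/
def degen1 (A : Type) [Ring A] [Algebra ℂ A] : Submodule ℂ (A ⊗[ℂ] A) :=
  Submodule.span ℂ {x | ∃ m : A, x = m ⊗ₜ[ℂ] 1}

/-- The degenerate 2-chains; `C_2 / degen2 = A ⊗ (A / ℂ) ⊗ (A / ℂ)`. -/
def degen2 (A : Type) [Ring A] [Algebra ℂ A] : Submodule ℂ (A ⊗[ℂ] (A ⊗[ℂ] A)) :=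
  Submodule.span ℂ {x | ∃ m a : A, x = m ⊗ₜ[ℂ] (1 ⊗ₜ[ℂ] a) ∨ x = m ⊗ₜ[ℂ] (a ⊗ₜ[ℂ] 1)}

/-- The degenerate 3-chains; `C_3 / degen3 = A ⊗ (A / ℂ) ⊗ (A / ℂ) ⊗ (A / ℂ)`. -/
def degen3 (A : Type) [Ring A] [Algebra ℂ A] : Submodule ℂ (A ⊗[ℂ] (A ⊗[ℂ] (A ⊗[ℂ] A))) :=
  Submodule.span ℂ {x | ∃ m a b : A, x = m ⊗ₜ[ℂ] (1 ⊗ₜ[ℂ] (a ⊗ₜ[ℂ] b)) ∨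
    x = m ⊗ₜ[ℂ] (a ⊗ₜ[ℂ] (1 ⊗ₜ[ℂ] b)) ∨ x = m ⊗ₜ[ℂ] (a ⊗ₜ[ℂ] (b ⊗ₜ[ℂ] 1))}

theorem hochB2_degen (σ : A →ₐ[ℂ] A) : degen2 A ≤ (degen1 A).comap (hochB2 σ) := by
  rw [degen2, Submodule.span_le]
  rintro x ⟨m, a, rfl | rfl⟩
  · have : hochB2 σ (m ⊗ₜ[ℂ] (1 ⊗ₜ[ℂ] a)) = (σ a * m) ⊗ₜ[ℂ] 1 := by simp [hochB2_tmul]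
    exact Submodule.mem_comap.2 (this ▸ Submodule.subset_span ⟨_, rfl⟩)
  · have : hochB2 σ (m ⊗ₜ[ℂ] (a ⊗ₜ[ℂ] 1)) = (m * a) ⊗ₜ[ℂ] 1 := by simp [hochB2_tmul]
    exact Submodule.mem_comap.2 (this ▸ Submodule.subset_span ⟨_, rfl⟩)

theorem hochB3_degen (σ : A →ₐ[ℂ] A) : degen3 A ≤ (degen2 A).comap (hochB3 σ) := by
  have h1 : ∀ m a : A, m ⊗ₜ[ℂ] (1 ⊗ₜ[ℂ] a) ∈ degen2 A := fun m a =>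
    Submodule.subset_span ⟨m, a, Or.inl rfl⟩
  have h2 : ∀ m a : A, m ⊗ₜ[ℂ] (a ⊗ₜ[ℂ] 1) ∈ degen2 A := fun m a =>
    Submodule.subset_span ⟨m, a, Or.inr rfl⟩
  rw [degen3, Submodule.span_le]
  rintro x ⟨m, a, b, rfl | rfl | rfl⟩ <;>
    simp only [SetLike.mem_coe, Submodule.mem_comap, hochB3_tmul, mul_one, one_mul, map_one]
  · rw [sub_self, zero_add]
    exact sub_mem (h1 _ _) (h1 _ _)
  · rw [sub_add_cancel]
    exact sub_mem (h1 _ _) (h2 _ _)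
  · rw [add_sub_cancel_right]
    exact sub_mem (h2 _ _) (h2 _ _)

/-- The boundary of the normalized twisted Hochschild complex in degree 2. -/
def normB2 (σ : A →ₐ[ℂ] A) :
    ((A ⊗[ℂ] (A ⊗[ℂ] A)) ⧸ degen2 A) →ₗ[ℂ] ((A ⊗[ℂ] A) ⧸ degen1 A) :=
  (degen2 A).mapQ (degen1 A) (hochB2 σ) (hochB2_degen σ)

/-- The boundary of the normalized twisted Hochschild complex in degree 3. -/
def normB3 (σ : A →ₐ[ℂ] A) :
    ((A ⊗[ℂ] (A ⊗[ℂ] (A ⊗[ℂ] A))) ⧸ degen3 A) →ₗ[ℂ] ((A ⊗[ℂ] (A ⊗[ℂ] A)) ⧸ degen2 A) :=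
  (degen3 A).mapQ (degen2 A) (hochB3 σ) (hochB3_degen σ)

/-- The degree 2 homology of the normalized twisted Hochschild complex. -/
def NormHH2 (σ : A →ₐ[ℂ] A) : Type := HomologyAt (normB3 σ) (normB2 σ)

instance (σ : A →ₐ[ℂ] A) : AddCommGroup (NormHH2 σ) :=
  inferInstanceAs (AddCommGroup (HomologyAt (normB3 σ) (normB2 σ)))

instance (σ : A →ₐ[ℂ] A) : Module ℂ (NormHH2 σ) :=
  inferInstanceAs (Module ℂ (HomologyAt (normB3 σ) (normB2 σ)))

/-- The chain `c` is a cycle in the normalized complex. -/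
def IsNormCycle (σ : A →ₐ[ℂ] A) (c : A ⊗[ℂ] (A ⊗[ℂ] A)) : Prop :=
  normB2 σ ((degen2 A).mkQ c) = 0

/-- The class in the normalized homology of a chain that is a cycle in the normalized complex. -/
def normClass (σ : A →ₐ[ℂ] A) (c : A ⊗[ℂ] (A ⊗[ℂ] A)) (hc : IsNormCycle σ c) : NormHH2 σ :=
  HomologyAt.mk (normB3 σ) (normB2 σ) ((degen2 A).mkQ c) hc

/-- The canonical map from the Hochschild homology to the normalized one, induced by the projection
of complexes. -/
def toNorm (σ : A →ₐ[ℂ] A) : HH2 σ →ₗ[ℂ] NormHH2 σ :=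
  HomologyAt.map (hochB3 σ) (hochB2 σ) (normB3 σ) (normB2 σ) (degen3 A).mkQ (degen2 A).mkQ
    (degen1 A).mkQ (fun _ => rfl) (fun _ => rfl)

/-- The 2-chain `C(P) = Tr (V (2 P - Id) ⊗ P ⊗ P)`. -/
def chainC {n : ℕ} (V : Matrix (Fin n) (Fin n) ℂ) (P : Matrix (Fin n) (Fin n) A) :
    A ⊗[ℂ] (A ⊗[ℂ] A) :=
  ∑ j, ∑ k, ∑ l, (V.map (algebraMap ℂ A) * (2 • P - 1) : Matrix (Fin n) (Fin n) A) j k ⊗ₜ[ℂ] (P k l ⊗ₜ[ℂ] P l j)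

end hochschild
end
end QGrass

open QGrass

/-! Everything is reduced to matrix identities. Write `π` for the fundamental representation, `p`
for the projection onto the span of `v_1, …, v_r`, and `V` for `π(K_(2ρ)⁻¹)`. Since `(u^m_i)*(X) =
π(S(X))^i_m` (`dualStar_u_apply`), the value of the matrix `P` at `X` is `π(S(X₁)) p π(X₂)`, the
right adjoint action of `X` on `p` (`projP_apply`). As `p` commutes with the image of the Levi
factor, it is invariant: this gives both the invariance of `w`, which is `p` under `V(ω_1) ⊗ V(ω_1)*
≅ End V(ω_1)`, and the fact that `P` has entries in the Grassmannian. Also `P = u* p u` with `u u* =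
1`, hence `P² = P`. Finally `V` implements the square of the antipode, so `Tr(VP)` is the counit
times the number `Tr(pV)`.

Cycle: `θ(P) = V P V⁻¹` because `K_(2ρ)` is group-like and is absorbed on the left. Together with
`P² = P` this collapses the boundary of `C(P)` to `1 ⊗ Tr(VP)`, a multiple of `1 ⊗ 1`, which is
degenerate (`chainC_isNormCycle`).

Non-triviality: evaluation at `1` is a `θ`-invariant character of the Grassmannian, the classical
base point. Evaluations at `E_r` and `F_r` are derivations over it, because the factors `K_r^(±1)`
in the coproducts act trivially there. The cup product of these two derivations is a normalized
twisted 2-cocycle (`normClass_ne_zero`), and its value on `C(P)` is `-q^(2r-2-N)`, which is not zero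
(`cupCochain_chainC`).

Lifting: for any algebra and twist, the projection to the normalized complex is bijective on `H_2`
(`toNorm_injective`, `toNorm_surjective`), so the normalized class has exactly one preimage, and it
is non-zero. -/

namespace QGrass
noncomputable section

/-! ### Twisted Hochschild homology of an arbitrary algebra: normalization, cocycles, idempotents -/

section hochschildLemmas
variable {A : Type} [Ring A] [Algebra ℂ A]

theorem hochB2_hochB3 (σ : A →ₐ[ℂ] A) (x : A ⊗[ℂ] (A ⊗[ℂ] (A ⊗[ℂ] A))) :
    hochB2 σ (hochB3 σ x) = 0 := by
  have : hochB2 σ ∘ₗ hochB3 σ = 0 := by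
    ext m a b c
    simp only [TensorProduct.AlgebraTensorModule.curry_apply, TensorProduct.curry_apply,
      LinearMap.coe_restrictScalars, LinearMap.comp_apply, hochB3_tmul, hochB2_tmul, map_sub,
      map_add, LinearMap.zero_apply, map_mul, mul_assoc]
    abel
  exact LinearMap.congr_fun this x

/-- Modulo boundaries, every degenerate 2-chain has the form `t ⊗ 1 ⊗ 1`. -/
theorem degen2_reduce (σ : A →ₐ[ℂ] A) {d : A ⊗[ℂ] (A ⊗[ℂ] A)} (hd : d ∈ degen2 A) :
    ∃ (t : A) (x : A ⊗[ℂ] (A ⊗[ℂ] (A ⊗[ℂ] A))), d = t ⊗ₜ[ℂ] (1 ⊗ₜ[ℂ] 1) + hochB3 σ x := by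
  rw [degen2] at hd
  induction hd using Submodule.span_induction with
  | zero => exact ⟨0, 0, by simp⟩
  | add x y _ _ hx hy =>
    obtain ⟨t, x, rfl⟩ := hx
    obtain ⟨s, y, rfl⟩ := hy
    exact ⟨t + s, x + y, by rw [TensorProduct.add_tmul, map_add]; abel⟩
  | smul c x _ hx =>
    obtain ⟨t, x, rfl⟩ := hx
    exact ⟨c • t, c • x, by rw [smul_add, map_smul, TensorProduct.smul_tmul']⟩
  | mem x hx =>
    obtain ⟨m, a, rfl | rfl⟩ := hx
    -- The boundary of `m ⊗ 1 ⊗ 1 ⊗ a` is `m ⊗ 1 ⊗ a - σ(a)m ⊗ 1 ⊗ 1`, and that of `m ⊗ a ⊗ 1 ⊗ 1`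
    -- is `ma ⊗ 1 ⊗ 1 - m ⊗ a ⊗ 1`; the latter explains the sign in the next witness.
    · exact ⟨σ a * m, m ⊗ₜ (1 ⊗ₜ (1 ⊗ₜ a)), by simp [hochB3_tmul]⟩
    · exact ⟨m * a, -(m ⊗ₜ (a ⊗ₜ (1 ⊗ₜ 1))), by simp [hochB3_tmul]⟩

/-- By `degen2_reduce` only `t ⊗ 1 ⊗ 1` has to be excluded. Its boundary is `t ⊗ 1`, so the cycle
condition says `t ⊗ 1 = 0`. -/
theorem degen2_cycle_eq_boundary (σ : A →ₐ[ℂ] A) {d : A ⊗[ℂ] (A ⊗[ℂ] A)} (hd : d ∈ degen2 A)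
    (hb : hochB2 σ d = 0) : ∃ x, d = hochB3 σ x := by
  obtain ⟨t, x, rfl⟩ := degen2_reduce σ hd
  rw [map_add, hochB2_hochB3, add_zero, hochB2_tmul] at hb
  simp only [mul_one, map_one, one_mul, sub_self, zero_add] at hb
  -- Tensoring `t ⊗ 1 = 0` with a further `1` already kills `t ⊗ 1 ⊗ 1`, without concluding `t = 0`.
  have h := congrArg (TensorProduct.assoc ℂ A A A ∘ fun y => y ⊗ₜ[ℂ] (1 : A)) hb
  simp only [Function.comp_apply, TensorProduct.assoc_tmul, TensorProduct.zero_tmul, map_zero] at h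
  exact ⟨x, by rw [h, zero_add]⟩

/-- A cycle that bounds in the normalized complex differs from a true boundary by a degenerate
chain. That chain is itself a cycle, hence a boundary. -/
theorem toNorm_injective (σ : A →ₐ[ℂ] A) : Function.Injective (toNorm σ) := by
  rw [injective_iff_map_eq_zero]
  intro h
  obtain ⟨⟨c, hc⟩, rfl⟩ := Submodule.Quotient.mk_surjective _ h
  intro h0
  obtain ⟨y, hy⟩ := (Submodule.Quotient.mk_eq_zero _).1 h0
  obtain ⟨x, rfl⟩ := Submodule.Quotient.mk_surjective _ y
  have hy' : (degen2 A).mkQ (hochB3 σ x) = (degen2 A).mkQ c := hy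
  rw [← sub_eq_zero, ← map_sub, Submodule.mkQ_apply, Submodule.Quotient.mk_eq_zero] at hy'
  rw [LinearMap.mem_ker] at hc
  obtain ⟨z, hz⟩ := degen2_cycle_eq_boundary σ hy' (by rw [map_sub, hochB2_hochB3, hc, sub_zero])
  refine (Submodule.Quotient.mk_eq_zero _).2 ⟨x - z, ?_⟩
  rw [map_sub, ← hz]
  exact sub_sub_cancel _ _

/-- A lift of a normalized cycle has degenerate boundary. Since `m ⊗ 1` is the boundary of the
degenerate chain `m ⊗ 1 ⊗ 1`, the lift can be corrected by a degenerate chain into a true cycle. -/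
theorem toNorm_surjective (σ : A →ₐ[ℂ] A) : Function.Surjective (toNorm σ) := by
  intro h
  obtain ⟨⟨y, hy⟩, rfl⟩ := Submodule.Quotient.mk_surjective _ h
  obtain ⟨c, rfl⟩ := Submodule.Quotient.mk_surjective _ y
  have hc : hochB2 σ c ∈ degen1 A := (Submodule.Quotient.mk_eq_zero _).1 hy
  have hd : ∀ z ∈ degen1 A, ∃ d ∈ degen2 A, hochB2 σ d = z := by
    intro z hz
    rw [degen1] at hz
    induction hz using Submodule.span_induction with
    | zero => exact ⟨0, zero_mem _, map_zero _⟩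
    | add x y _ _ hx hy =>
      obtain ⟨d, hd, rfl⟩ := hx
      obtain ⟨e, he, rfl⟩ := hy
      exact ⟨d + e, add_mem hd he, map_add _ _ _⟩
    | smul c x _ hx =>
      obtain ⟨d, hd, rfl⟩ := hx
      exact ⟨c • d, Submodule.smul_mem _ _ hd, map_smul _ _ _⟩
    | mem x hx =>
      obtain ⟨m, rfl⟩ := hx
      exact ⟨m ⊗ₜ (1 ⊗ₜ 1), Submodule.subset_span ⟨m, 1, Or.inl rfl⟩, by simp [hochB2_tmul]⟩
  obtain ⟨d, hd, hdc⟩ := hd _ hc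
  refine ⟨HomologyAt.mk (hochB3 σ) (hochB2 σ) (c - d) (by rw [map_sub, hdc, sub_self]), ?_⟩
  refine congrArg Submodule.Quotient.mk (Subtype.ext ?_)
  change (degen2 A).mkQ (c - d) = (degen2 A).mkQ c
  rw [map_sub, sub_eq_self]
  exact (Submodule.Quotient.mk_eq_zero _).2 hd

/-- The cochain `a₀ ⊗ a₁ ⊗ a₂ ↦ e(a₀) D₁(a₁) D₂(a₂)`. -/
def cupCochain (e D₁ D₂ : A →ₗ[ℂ] ℂ) : A ⊗[ℂ] (A ⊗[ℂ] A) →ₗ[ℂ] ℂ :=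
  LinearMap.mul' ℂ ℂ ∘ₗ TensorProduct.map e (LinearMap.mul' ℂ ℂ ∘ₗ TensorProduct.map D₁ D₂)

theorem cupCochain_tmul (e D₁ D₂ : A →ₗ[ℂ] ℂ) (a b c : A) :
    cupCochain e D₁ D₂ (a ⊗ₜ (b ⊗ₜ c)) = e a * (D₁ b * D₂ c) := by
  simp [cupCochain]

/-- Two derivations at a `σ`-invariant character detect non-trivial classes. -/
theorem normClass_ne_zero (σ : A →ₐ[ℂ] A) (e D₁ D₂ : A →ₗ[ℂ] ℂ) (he1 : e 1 = 1)
    (he : ∀ a b, e (a * b) = e a * e b) (heσ : ∀ a, e (σ a) = e a)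
    (h₁ : ∀ a b, D₁ (a * b) = D₁ a * e b + e a * D₁ b)
    (h₂ : ∀ a b, D₂ (a * b) = D₂ a * e b + e a * D₂ b)
    (c : A ⊗[ℂ] (A ⊗[ℂ] A)) (hc : IsNormCycle σ c) (hne : cupCochain e D₁ D₂ c ≠ 0) :
    normClass σ c hc ≠ 0 := by
  have one₁ : D₁ 1 = 0 := by simpa [he1] using h₁ 1 1
  have one₂ : D₂ 1 = 0 := by simpa [he1] using h₂ 1 1
  -- Expanding by the Leibniz rules, the four faces telescope. The invariance of `e` under `σ`
  -- enters only in the last face, where `σ(c)` multiplies the coefficient.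
  have hb : cupCochain e D₁ D₂ ∘ₗ hochB3 σ = 0 := by
    ext m a b c
    simp only [TensorProduct.AlgebraTensorModule.curry_apply, TensorProduct.curry_apply,
      LinearMap.coe_restrictScalars, LinearMap.comp_apply, hochB3_tmul, map_sub,
      map_add, LinearMap.zero_apply, cupCochain_tmul, he, heσ, h₁, h₂]
    ring
  have hd : ∀ d ∈ degen2 A, cupCochain e D₁ D₂ d = 0 := by
    intro d hd
    have : degen2 A ≤ LinearMap.ker (cupCochain e D₁ D₂) := by
      rw [degen2, Submodule.span_le]
      rintro x ⟨m, a, rfl | rfl⟩ <;> simp [cupCochain_tmul, one₁, one₂]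
    exact this hd
  intro h0
  obtain ⟨y, hy⟩ := (Submodule.Quotient.mk_eq_zero _).1 h0
  obtain ⟨x, rfl⟩ := Submodule.Quotient.mk_surjective _ y
  have hy' : (degen2 A).mkQ (hochB3 σ x) = (degen2 A).mkQ c := hy
  rw [← sub_eq_zero, ← map_sub, Submodule.mkQ_apply, Submodule.Quotient.mk_eq_zero] at hy'
  have h := hd _ hy'
  rw [map_sub, ← LinearMap.comp_apply, hb, LinearMap.zero_apply, zero_sub, neg_eq_zero] at h
  exact hne h

/-- With `X = V(2P - 1)`, the idempotent law and the twisted commutation give `XP = σ(P)X = VP`. So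
the two outer faces agree, and the total is `∑ (2VP - X)_jk ⊗ P_kj = ∑ V_jk ⊗ P_kj = 1 ⊗ Tr(VP)`. -/
theorem chainC_isNormCycle {n : ℕ} (σ : A →ₐ[ℂ] A) (V : Matrix (Fin n) (Fin n) ℂ)
    (P : Matrix (Fin n) (Fin n) A) (hP : P * P = P)
    (hσ : P.map σ * V.map (algebraMap ℂ A) = V.map (algebraMap ℂ A) * P) {t : ℂ}
    (ht : Matrix.trace (V.map (algebraMap ℂ A) * P) = algebraMap ℂ A t) :
    IsNormCycle σ (chainC V P) := by
  set W : Matrix (Fin n) (Fin n) A := V.map (algebraMap ℂ A) with hW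
  obtain ⟨X, hX⟩ : ∃ X : Matrix (Fin n) (Fin n) A, X = W * (2 • P - 1) := ⟨_, rfl⟩
  have e1 : X * P = W * P := by
    rw [hX, mul_assoc, sub_mul, one_mul, smul_mul_assoc, hP, two_smul, add_sub_cancel_right]
  have e2 : P.map σ * X = W * P := by
    rw [hX, ← mul_assoc, hσ, mul_assoc, mul_sub, mul_one, mul_smul_comm, hP, two_smul,
      add_sub_cancel_right]
  have key : hochB2 σ (chainC V P) = 1 ⊗ₜ Matrix.trace (W * P) := by
    have s1 : ∑ j, ∑ k, ∑ l, (X j k * P k l) ⊗ₜ[ℂ] P l j =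
        ∑ j, ∑ k, (W * P) j k ⊗ₜ[ℂ] P k j := by
      refine Finset.sum_congr rfl fun j _ => ?_
      rw [Finset.sum_comm]
      refine Finset.sum_congr rfl fun l _ => ?_
      rw [← TensorProduct.sum_tmul, ← Matrix.mul_apply, e1]
    have s2 : ∑ j, ∑ k, ∑ l, X j k ⊗ₜ[ℂ] (P k l * P l j) =
        ∑ j, ∑ k, X j k ⊗ₜ[ℂ] P k j := by
      refine Finset.sum_congr rfl fun j _ => Finset.sum_congr rfl fun k _ => ?_
      rw [← TensorProduct.tmul_sum, ← Matrix.mul_apply, hP]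
    -- In the twisted face the contracted index is `j`; the sums are permuted cyclically so that the
    -- product `σ(P)X` appears.
    have s3 : ∑ j, ∑ k, ∑ l, (σ (P l j) * X j k) ⊗ₜ[ℂ] P k l =
        ∑ j, ∑ k, (W * P) j k ⊗ₜ[ℂ] P k j := by
      have : ∀ l k, (W * P) l k ⊗ₜ[ℂ] P k l =
          ∑ j, (σ (P l j) * X j k) ⊗ₜ[ℂ] P k l := by
        intro l k
        rw [← TensorProduct.sum_tmul, ← e2, Matrix.mul_apply]
        simp only [Matrix.map_apply]
      simp only [this]
      rw [Finset.sum_comm, Finset.sum_comm_cycle]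
    have s4 : (1 : A) ⊗ₜ[ℂ] Matrix.trace (W * P) = ∑ j, ∑ k, W j k ⊗ₜ[ℂ] P k j := by
      simp only [Matrix.trace, Matrix.diag, Matrix.mul_apply, TensorProduct.tmul_sum]
      refine Finset.sum_congr rfl fun j _ => Finset.sum_congr rfl fun k _ => ?_
      rw [hW, Matrix.map_apply, Algebra.algebraMap_eq_smul_one, smul_one_mul,
        TensorProduct.smul_tmul]
    rw [chainC, ← hW, ← hX]
    simp only [map_sum, hochB2_tmul, Finset.sum_add_distrib, Finset.sum_sub_distrib]
    rw [s1, s2, s3, s4, hX, mul_sub, mul_one, mul_smul_comm, ← sub_eq_zero]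
    simp only [← Finset.sum_add_distrib, ← Finset.sum_sub_distrib]
    refine Finset.sum_eq_zero fun j _ => Finset.sum_eq_zero fun k _ => ?_
    rw [Matrix.sub_apply, two_smul, Matrix.add_apply, TensorProduct.sub_tmul,
      TensorProduct.add_tmul]
    abel
  refine (Submodule.Quotient.mk_eq_zero _).2 ?_
  -- The boundary is `t • (1 ⊗ 1)`. It vanishes only modulo degenerate chains, which is why the
  -- normalized complex is needed here.
  rw [key, ht, Algebra.algebraMap_eq_smul_one, TensorProduct.tmul_smul]
  exact Submodule.smul_mem _ _ (Submodule.subset_span ⟨1, rfl⟩)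

end hochschildLemmas

/-! ### Induction on generators; antipode and involution of `U_q(sl(N))` -/

namespace Uq
variable {N : ℕ} {q : ℝ}

/-- Reduces the generators `K_λ` to the `K_i` and their inverses, so that later arguments only check
`E_i`, `F_i`, `K_i`, `K_i⁻¹`. -/
theorem levi_induction {T : Set (Fin (N - 1))} {p : Uq N q → Prop}
    (hE : ∀ i ∈ T, p (E i)) (hF : ∀ i ∈ T, p (F i)) (hK : ∀ i, p (K i)) (hL : ∀ i, p (Kinv i))
    (halg : ∀ c : ℂ, p (algebraMap ℂ _ c)) (hadd : ∀ X Y, p X → p Y → p (X + Y))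
    (hmul : ∀ X Y, p X → p Y → p (X * Y)) {X : Uq N q} (hX : X ∈ levi N q T) : p X := by
  induction hX using Algebra.adjoin_induction with
  | algebraMap c => exact halg c
  | add x y _ _ hx hy => exact hadd x y hx hy
  | mul x y _ _ hx hy => exact hmul x y hx hy
  | mem x hx =>
    rcases hx with ⟨lam, rfl⟩ | ⟨i, hi, rfl⟩ | ⟨i, hi, rfl⟩
    -- Requiring the property for a unit and for its inverse yields a subgroup, which therefore
    -- contains all products of integer powers of the `K_i`.
    · let H : Subgroup (Uq N q)ˣ :=
        { carrier := {v | p (v : Uq N q) ∧ p ((v⁻¹ : (Uq N q)ˣ) : Uq N q)}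
          one_mem' := by
            have := halg 1
            rw [map_one] at this
            exact ⟨this, by simpa using this⟩
          mul_mem' := by
            intro a b ha hb
            exact ⟨hmul _ _ ha.1 hb.1, by rw [mul_inv_rev]; exact hmul _ _ hb.2 ha.2⟩
          inv_mem' := by
            intro a ha
            exact ⟨ha.2, by rw [inv_inv]; exact ha.1⟩ }
      have : kLam N q lam ∈ H := by
        apply Subgroup.list_prod_mem
        intro x hx
        obtain ⟨i, -, rfl⟩ := List.mem_map.1 hx
        exact Subgroup.zpow_mem H (show kUnit i ∈ H from ⟨hK i, hL i⟩) _
      exact this.1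
    · exact hE i hi
    · exact hF i hi

/-- Turns `levi_induction` into an induction principle for all of `U_q(sl(N))`. -/
theorem mem_levi_univ (X : Uq N q) : X ∈ levi N q Set.univ := by
  obtain ⟨x, rfl⟩ := RingQuot.mkAlgHom_surjective ℂ (Rel (N - 1) q) X
  induction x using FreeAlgebra.induction with
  | grade0 c => rw [AlgHom.commutes]; exact Subalgebra.algebraMap_mem _ c
  | mul a b ha hb => rw [map_mul]; exact mul_mem ha hb
  | add a b ha hb => rw [map_add]; exact add_mem ha hb
  | grade1 x =>
    cases x with
    | E i => exact Algebra.subset_adjoin (Or.inr (Or.inl ⟨i, trivial, rfl⟩))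
    | F i => exact Algebra.subset_adjoin (Or.inr (Or.inr ⟨i, trivial, rfl⟩))
    | K i => exact Algebra.subset_adjoin (Or.inl ⟨Pi.single i 1, by
        dsimp only; rw [kLam_single, zpow_one]; rfl⟩)
    | Kinv i => exact Algebra.subset_adjoin (Or.inl ⟨Pi.single i (-1), by
        dsimp only; rw [kLam_single, zpow_neg_one]; rfl⟩)

variable [Fact (0 < q)]

theorem S_mul (X Y : Uq N q) : S N q (X * Y) = S N q Y * S N q X := by
  simp [S]

theorem S_algebraMap (c : ℂ) : S N q (algebraMap ℂ _ c) = algebraMap ℂ _ c := by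
  simp [S]

theorem S_one : S N q 1 = 1 := by simp [S]

theorem S_E (i : Fin (N - 1)) : S N q (E i) = -(E i * Kinv i) := by simp [S, antipodeHom]
theorem S_F (i : Fin (N - 1)) : S N q (F i) = -(K i * F i) := by simp [S, antipodeHom]
theorem S_K (i : Fin (N - 1)) : S N q (K i) = Kinv i := by simp [S, antipodeHom]
theorem S_Kinv (i : Fin (N - 1)) : S N q (Kinv i) = K i := by simp [S, antipodeHom]

theorem starMap_mul (X Y : Uq N q) : starMap (X * Y) = starMap Y * starMap X := by
  simp only [starMap, map_mul]; rfl

theorem starMap_add (X Y : Uq N q) : starMap (X + Y) = starMap X + starMap Y := by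
  simp only [starMap, map_add]; rfl

theorem starMap_neg (X : Uq N q) : starMap (-X) = -starMap X := by
  simp only [starMap, map_neg]; rfl

theorem starMap_algebraMap (c : ℂ) :
    starMap (algebraMap ℂ (Uq N q) c) = algebraMap ℂ _ (starRingEnd ℂ c) := by
  simp only [starMap, AlgHom.commutes]; rfl

theorem starMap_E (i : Fin (N - 1)) : starMap (E i : Uq N q) = K i * F i :=
  congrArg ConjOp.un (lift_E _ i)
theorem starMap_F (i : Fin (N - 1)) : starMap (F i : Uq N q) = E i * Kinv i :=
  congrArg ConjOp.un (lift_F _ i)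
theorem starMap_K (i : Fin (N - 1)) : starMap (K i : Uq N q) = K i :=
  congrArg ConjOp.un (lift_K _ i)
theorem starMap_Kinv (i : Fin (N - 1)) : starMap (Kinv i : Uq N q) = Kinv i :=
  congrArg ConjOp.un (lift_L _ i)

end Uq

/-! ### Adjoint actions on matrices through the fundamental representation -/

section sandwich
variable {N : ℕ} {q : ℝ} [Fact (0 < q)] [Fact (q ≠ 1)]

@[simp] theorem fundRep_E (i : Fin (N - 1)) : fundRep N q (Uq.E i) = fundE N q i := by
  simp [fundRep]
@[simp] theorem fundRep_F (i : Fin (N - 1)) : fundRep N q (Uq.F i) = fundF N q i := by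
  simp [fundRep]
@[simp] theorem fundRep_K (i : Fin (N - 1)) : fundRep N q (Uq.K i) = fundK N q i := by
  simp [fundRep]
@[simp] theorem fundRep_Kinv (i : Fin (N - 1)) : fundRep N q (Uq.Kinv i) = fundKinv N q i := by
  simp [fundRep]

/-- The fundamental representation relates the compact real form to the adjoint of matrices. -/
theorem fundRep_starMap (X : Uq N q) : fundRep N q (Uq.starMap X) = (fundRep N q X).conjTranspose := by
  have hq : 0 < q := Fact.out
  have hs : (Real.sqrt q : ℂ) ≠ 0 := by exact_mod_cast (Real.sqrt_pos.2 hq).ne'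
  have hqs : (q : ℂ) = Real.sqrt q * Real.sqrt q := by
    exact_mod_cast (Real.mul_self_sqrt hq.le).symm
  -- Both sides are conjugate-linear and reverse products, so generators suffice. The factors
  -- `q^(±1/2)` in the definition of `π` are what makes `E_i* = K_i F_i` match: the entry of `K_i
  -- F_i` is `q⁻¹ q^(1/2) = q^(-1/2)`.
  refine Uq.levi_induction (p := fun X => fundRep N q (Uq.starMap X) = (fundRep N q X).conjTranspose)
    ?hE ?hF ?hK ?hL ?halg ?hadd ?hmul (Uq.mem_levi_univ X)
  case hE =>
    intro i _
    rw [Uq.starMap_E, map_mul, fundRep_K, fundRep_F, fundRep_E]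
    ext a b
    simp only [fundK, fundF, fundE, Matrix.diagonal_mul, Matrix.conjTranspose_apply,
      Matrix.single_apply, Fin.ext_iff]
    by_cases h : (i : ℕ) + 1 = a ∧ (i : ℕ) = b
    · simp only [h.2, and_self, if_true, fundWeight, ← h.1]
      simp [hqs, hs]
    · rw [if_neg h, if_neg (fun h' => h ⟨h'.2, h'.1⟩)]; simp
  case hF =>
    intro i _
    rw [Uq.starMap_F, map_mul, fundRep_E, fundRep_Kinv, fundRep_F]
    ext a b
    simp only [fundKinv, fundF, fundE, Matrix.mul_diagonal, Matrix.conjTranspose_apply,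
      Matrix.single_apply, Fin.ext_iff]
    by_cases h : (i : ℕ) = a ∧ (i : ℕ) + 1 = b
    · simp only [h.1, and_self, if_true, fundWeight, ← h.2]
      simp [hqs, hs]
    · rw [if_neg h, if_neg (fun h' => h ⟨h'.2, h'.1⟩)]; simp
  case hK =>
    intro i
    rw [Uq.starMap_K, fundRep_K, fundK, Matrix.diagonal_conjTranspose]
    congr 1; ext m; simp
  case hL =>
    intro i
    rw [Uq.starMap_Kinv, fundRep_Kinv, fundKinv, Matrix.diagonal_conjTranspose]
    congr 1; ext m; simp
  case halg =>
    intro c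
    rw [Uq.starMap_algebraMap, AlgHom.commutes, AlgHom.commutes, Matrix.algebraMap_eq_diagonal,
      Matrix.algebraMap_eq_diagonal, Matrix.diagonal_conjTranspose]
    rfl
  case hadd =>
    intro X Y hX hY
    rw [Uq.starMap_add, map_add, map_add, Matrix.conjTranspose_add, hX, hY]
  case hmul =>
    intro X Y hX hY
    rw [Uq.starMap_mul, map_mul, map_mul, Matrix.conjTranspose_mul, hX, hY]

/-- `X ↦ π(S(X))`. -/
def fundS (N : ℕ) (q : ℝ) [Fact (0 < q)] [Fact (q ≠ 1)] :
    Uq N q →ₗ[ℂ] Matrix (Fin N) (Fin N) ℂ :=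
  (fundRep N q).toLinearMap ∘ₗ Uq.S N q

theorem fundS_apply (X : Uq N q) : fundS N q X = fundRep N q (Uq.S N q X) := rfl

theorem fundS_mul (X Y : Uq N q) : fundS N q (X * Y) = fundS N q Y * fundS N q X := by
  rw [fundS_apply, Uq.S_mul, map_mul]; rfl

@[simp] theorem fundS_E (i : Fin (N - 1)) :
    fundS N q (Uq.E i) = -(fundE N q i * fundKinv N q i) := by
  simp [fundS_apply, Uq.S_E]
@[simp] theorem fundS_F (i : Fin (N - 1)) :
    fundS N q (Uq.F i) = -(fundK N q i * fundF N q i) := by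
  simp [fundS_apply, Uq.S_F]
@[simp] theorem fundS_K (i : Fin (N - 1)) : fundS N q (Uq.K i) = fundKinv N q i := by
  simp [fundS_apply, Uq.S_K]
@[simp] theorem fundS_Kinv (i : Fin (N - 1)) : fundS N q (Uq.Kinv i) = fundK N q i := by
  simp [fundS_apply, Uq.S_Kinv]
@[simp] theorem fundS_one : fundS N q 1 = 1 := by
  simp [fundS_apply, Uq.S_one]

/-- The two complex conjugations, one from the star on functionals and one from the adjoint matrix,
cancel; only the antipode and a transposition of indices remain. -/
theorem dualStar_u_apply (m i : Fin N) (X : Uq N q) :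
    dualStar (u N q m i) X = fundS N q X i m := by
  change starRingEnd ℂ (fundRep N q (Uq.starMap (Uq.S N q X)) m i) = _
  rw [fundRep_starMap, Matrix.conjTranspose_apply, fundS_apply]
  exact star_star _

/-- `a ⊗ b ↦ f(a) M g(b)`. -/
def sandwich {n : ℕ} (f g : Uq N q →ₗ[ℂ] Matrix (Fin n) (Fin n) ℂ) (M : Matrix (Fin n) (Fin n) ℂ) :
    Uq N q ⊗[ℂ] Uq N q →ₗ[ℂ] Matrix (Fin n) (Fin n) ℂ :=
  LinearMap.mul' ℂ _ ∘ₗ TensorProduct.map f (LinearMap.mulLeft ℂ M ∘ₗ g)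

omit [Fact (0 < q)] [Fact (q ≠ 1)] in
@[simp] theorem sandwich_tmul {n : ℕ} (f g : Uq N q →ₗ[ℂ] Matrix (Fin n) (Fin n) ℂ)
    (M : Matrix (Fin n) (Fin n) ℂ) (a b : Uq N q) :
    sandwich f g M (a ⊗ₜ b) = f a * M * g b := by
  simp [sandwich, mul_assoc]

/-- The right adjoint action `X ↦ π(S(X₁)) M π(X₂)`. -/
def adR (N : ℕ) (q : ℝ) [Fact (0 < q)] [Fact (q ≠ 1)] (M : Matrix (Fin N) (Fin N) ℂ) :
    Uq N q →ₗ[ℂ] Matrix (Fin N) (Fin N) ℂ :=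
  sandwich (fundS N q) (fundRep N q).toLinearMap M ∘ₗ Coalgebra.comul

/-- The left adjoint action `X ↦ π(X₁) M π(S(X₂))`. -/
def adL (N : ℕ) (q : ℝ) [Fact (0 < q)] [Fact (q ≠ 1)] (M : Matrix (Fin N) (Fin N) ℂ) :
    Uq N q →ₗ[ℂ] Matrix (Fin N) (Fin N) ℂ :=
  sandwich (fundRep N q).toLinearMap (fundS N q) M ∘ₗ Coalgebra.comul

/-- `X ↦ π(X₂) M π(S(X₁))`. -/
def adT (N : ℕ) (q : ℝ) [Fact (0 < q)] [Fact (q ≠ 1)] (M : Matrix (Fin N) (Fin N) ℂ) :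
    Uq N q →ₗ[ℂ] Matrix (Fin N) (Fin N) ℂ :=
  sandwich (fundRep N q).toLinearMap (fundS N q) M ∘ₗ
    (TensorProduct.comm ℂ (Uq N q) (Uq N q)).toLinearMap ∘ₗ Coalgebra.comul

/-- As `π ∘ S` reverses products, the factors of `w` wrap around those of `z`. This makes `adR` a
right action; the mirrored statement below makes `adL` and `adT` left actions. -/
theorem sandwich_SR_mul (M : Matrix (Fin N) (Fin N) ℂ) (z w : Uq N q ⊗[ℂ] Uq N q) :
    sandwich (fundS N q) (fundRep N q).toLinearMap M (z * w) =
      sandwich (fundS N q) (fundRep N q).toLinearMap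
        (sandwich (fundS N q) (fundRep N q).toLinearMap M z) w := by
  induction w using TensorProduct.induction_on with
  | zero => simp
  | add x y hx hy => rw [mul_add, map_add, map_add, hx, hy]
  | tmul a b =>
    induction z using TensorProduct.induction_on with
    | zero => simp
    | add x y hx hy => rw [add_mul, map_add, map_add, hx, hy]; simp [mul_add, add_mul]
    | tmul c d => simp [fundS_mul, mul_assoc]

theorem sandwich_RS_mul (M : Matrix (Fin N) (Fin N) ℂ) (z w : Uq N q ⊗[ℂ] Uq N q) :
    sandwich (fundRep N q).toLinearMap (fundS N q) M (z * w) =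
      sandwich (fundRep N q).toLinearMap (fundS N q)
        (sandwich (fundRep N q).toLinearMap (fundS N q) M w) z := by
  induction z using TensorProduct.induction_on with
  | zero => simp
  | add x y hx hy => rw [add_mul, map_add, map_add, hx, hy]
  | tmul a b =>
    induction w using TensorProduct.induction_on with
    | zero => simp
    | add x y hx hy => rw [mul_add, map_add, map_add, hx, hy]; simp [mul_add, add_mul]
    | tmul c d => simp [fundS_mul, mul_assoc]

theorem adR_mul (M : Matrix (Fin N) (Fin N) ℂ) (X Y : Uq N q) :
    adR N q M (X * Y) = adR N q (adR N q M X) Y := by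
  simp only [adR, LinearMap.comp_apply, Bialgebra.comul_mul, sandwich_SR_mul]

theorem adL_mul (M : Matrix (Fin N) (Fin N) ℂ) (X Y : Uq N q) :
    adL N q M (X * Y) = adL N q (adL N q M Y) X := by
  simp only [adL, LinearMap.comp_apply, Bialgebra.comul_mul, sandwich_RS_mul]

theorem comm_mul {A : Type} [Ring A] [Algebra ℂ A] (z w : A ⊗[ℂ] A) :
    TensorProduct.comm ℂ A A (z * w) = TensorProduct.comm ℂ A A z * TensorProduct.comm ℂ A A w :=
  map_mul (Algebra.TensorProduct.comm ℂ A A) z w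

theorem adT_mul (M : Matrix (Fin N) (Fin N) ℂ) (X Y : Uq N q) :
    adT N q M (X * Y) = adT N q (adT N q M Y) X := by
  simp only [adT, LinearMap.comp_apply, Bialgebra.comul_mul, LinearEquiv.coe_coe, comm_mul,
    sandwich_RS_mul]

omit [Fact (0 < q)] [Fact (q ≠ 1)] in
theorem sandwich_smul {n : ℕ} (f g : Uq N q →ₗ[ℂ] Matrix (Fin n) (Fin n) ℂ) (c : ℂ)
    (M : Matrix (Fin n) (Fin n) ℂ) (z : Uq N q ⊗[ℂ] Uq N q) :
    sandwich f g (c • M) z = c • sandwich f g M z := by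
  induction z using TensorProduct.induction_on with
  | zero => simp
  | add x y hx hy => rw [map_add, map_add, hx, hy, smul_add]
  | tmul a b => simp

section values
variable (M : Matrix (Fin N) (Fin N) ℂ) (i : Fin (N - 1))

theorem adR_E : adR N q M (Uq.E i) =
    -(fundE N q i * fundKinv N q i) * M * fundK N q i + M * fundE N q i := by
  simp [adR, Uq.comul_E]
theorem adR_F : adR N q M (Uq.F i) =
    -(fundK N q i * fundF N q i) * M + fundK N q i * M * fundF N q i := by
  simp [adR, Uq.comul_F]
theorem adR_K : adR N q M (Uq.K i) = fundKinv N q i * M * fundK N q i := by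
  simp [adR, Uq.comul_K]
theorem adR_Kinv : adR N q M (Uq.Kinv i) = fundK N q i * M * fundKinv N q i := by
  simp [adR, Uq.comul_L]
theorem adR_one : adR N q M 1 = M := by
  simp [adR, Algebra.TensorProduct.one_def]
theorem adR_algebraMap (c : ℂ) : adR N q M (algebraMap ℂ _ c) = c • M := by
  rw [Algebra.algebraMap_eq_smul_one, map_smul, adR_one]
theorem adL_E : adL N q M (Uq.E i) =
    fundE N q i * M * fundKinv N q i - M * (fundE N q i * fundKinv N q i) := by
  simp [adL, Uq.comul_E, sub_eq_add_neg]
theorem adL_F : adL N q M (Uq.F i) =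
    fundF N q i * M - fundKinv N q i * M * (fundK N q i * fundF N q i) := by
  simp [adL, Uq.comul_F, sub_eq_add_neg]
theorem adL_K : adL N q M (Uq.K i) = fundK N q i * M * fundKinv N q i := by
  simp [adL, Uq.comul_K]
theorem adL_Kinv : adL N q M (Uq.Kinv i) = fundKinv N q i * M * fundK N q i := by
  simp [adL, Uq.comul_L]
theorem adL_algebraMap (c : ℂ) : adL N q M (algebraMap ℂ _ c) = c • M := by
  rw [Algebra.algebraMap_eq_smul_one, map_smul]
  simp [adL, Algebra.TensorProduct.one_def]
theorem adT_E : adT N q M (Uq.E i) =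
    fundE N q i * M - fundK N q i * M * (fundE N q i * fundKinv N q i) := by
  simp [adT, Uq.comul_E]; abel
theorem adT_F : adT N q M (Uq.F i) =
    fundF N q i * M * fundK N q i - M * (fundK N q i * fundF N q i) := by
  simp [adT, Uq.comul_F]; abel
theorem adT_K : adT N q M (Uq.K i) = fundK N q i * M * fundKinv N q i := by
  simp [adT, Uq.comul_K]
theorem adT_Kinv : adT N q M (Uq.Kinv i) = fundKinv N q i * M * fundK N q i := by
  simp [adT, Uq.comul_L]
theorem adT_algebraMap (c : ℂ) : adT N q M (algebraMap ℂ _ c) = c • M := by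
  rw [Algebra.algebraMap_eq_smul_one, map_smul]
  simp [adT, Algebra.TensorProduct.one_def]

end values

theorem fundK_mul_fundKinv (i : Fin (N - 1)) : fundK N q i * fundKinv N q i = 1 :=
  (fund_qrel N q Fact.out Fact.out).K_mul_L i

theorem fundKinv_mul_fundK (i : Fin (N - 1)) : fundKinv N q i * fundK N q i = 1 :=
  (fund_qrel N q Fact.out Fact.out).L_mul_K i

/-- For `M` commuting with the Cartan part, the `K_i^(±1)` in the coproducts and antipodes cancel.
What remains at `E_i` is the commutator `[M, E_i]`, and at `F_i` it is `K_i [M, F_i]`. -/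
theorem adR_invariant {T : Set (Fin (N - 1))} {M : Matrix (Fin N) (Fin N) ℂ}
    (hK : ∀ i, Commute M (fundK N q i)) (hE : ∀ i ∈ T, Commute M (fundE N q i))
    (hF : ∀ i ∈ T, Commute M (fundF N q i)) {X : Uq N q} (hX : X ∈ Uq.levi N q T) :
    adR N q M X = Coalgebra.counit (R := ℂ) X • M := by
  refine Uq.levi_induction (p := fun X => adR N q M X = Coalgebra.counit (R := ℂ) X • M)
    ?hE ?hF ?hK ?hL ?halg ?hadd ?hmul hX
  case hE =>
    intro i hi
    rw [adR_E, Uq.counit_E, mul_assoc, (hK i).eq, neg_mul, mul_assoc,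
      ← mul_assoc (fundKinv N q i), fundKinv_mul_fundK, one_mul, (hE i hi).eq]; simp
  case hF =>
    intro i hi
    rw [adR_F, Uq.counit_F, mul_assoc (fundK N q i) M, (hF i hi).eq]; simp [mul_assoc]
  case hK =>
    intro i
    rw [adR_K, Uq.counit_K, mul_assoc, (hK i).eq, ← mul_assoc, fundKinv_mul_fundK]; simp
  case hL =>
    intro i
    rw [adR_Kinv, Uq.counit_L, ← (hK i).eq, mul_assoc, fundK_mul_fundKinv]; simp
  case halg =>
    intro c
    rw [adR_algebraMap, Bialgebra.counit_algebraMap]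
  case hadd =>
    intro X Y hX hY
    rw [map_add, map_add, hX, hY, add_smul]
  case hmul =>
    intro X Y hX hY
    rw [adR_mul, hX, adR, LinearMap.comp_apply, sandwich_smul, ← LinearMap.comp_apply, ← adR, hY,
      smul_smul, Bialgebra.counit_mul]

theorem adL_invariant {T : Set (Fin (N - 1))} {M : Matrix (Fin N) (Fin N) ℂ}
    (hK : ∀ i, Commute M (fundK N q i)) (hE : ∀ i ∈ T, Commute M (fundE N q i))
    (hF : ∀ i ∈ T, Commute M (fundF N q i)) {X : Uq N q} (hX : X ∈ Uq.levi N q T) :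
    adL N q M X = Coalgebra.counit (R := ℂ) X • M := by
  refine Uq.levi_induction (p := fun X => adL N q M X = Coalgebra.counit (R := ℂ) X • M)
    ?hE ?hF ?hK ?hL ?halg ?hadd ?hmul hX
  case hE =>
    intro i hi
    rw [adL_E, Uq.counit_E, ← (hE i hi).eq, mul_assoc]; simp
  case hF =>
    intro i hi
    rw [adL_F, Uq.counit_F, mul_assoc _ M, ← mul_assoc M, (hK i).eq, mul_assoc (fundK N q i),
      ← mul_assoc (fundKinv N q i), fundKinv_mul_fundK, one_mul, (hF i hi).eq]; simp
  case hK =>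
    intro i
    rw [adL_K, Uq.counit_K, ← (hK i).eq, mul_assoc, fundK_mul_fundKinv]; simp
  case hL =>
    intro i
    rw [adL_Kinv, Uq.counit_L, mul_assoc, (hK i).eq, ← mul_assoc, fundKinv_mul_fundK]; simp
  case halg =>
    intro c
    rw [adL_algebraMap, Bialgebra.counit_algebraMap]
  case hadd =>
    intro X Y hX hY
    rw [map_add, map_add, hX, hY, add_smul]
  case hmul =>
    intro X Y hX hY
    rw [adL_mul, hY, adL, LinearMap.comp_apply, sandwich_smul, ← LinearMap.comp_apply, ← adL, hX,
      smul_smul, Bialgebra.counit_mul, mul_comm]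

/-- A diagonal matrix implementing the square of the antipode is invariant for the twisted action. -/
theorem adT_invariant {M : Matrix (Fin N) (Fin N) ℂ} (hK : ∀ i, Commute M (fundK N q i))
    (hE : ∀ i, fundE N q i * M = (q : ℂ) ^ (2 : ℤ) • (M * fundE N q i))
    (hF : ∀ i, fundF N q i * M = (q : ℂ) ^ (-2 : ℤ) • (M * fundF N q i)) (X : Uq N q) :
    adT N q M X = Coalgebra.counit (R := ℂ) X • M := by
  have h := fund_qrel N q Fact.out Fact.out
  -- The hypotheses say `π(X) M = M π(S²(X))` on generators, as `S²(E_i) = q² E_i` and `S²(F_i) =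
  -- q⁻² F_i`. Formally then `π(X₂) M π(S(X₁)) = M π(S(X₁ S(X₂))) = ε(X) M`; the proof verifies the
  -- outcome on each generator.
  refine Uq.levi_induction (p := fun X => adT N q M X = Coalgebra.counit (R := ℂ) X • M)
    ?hE ?hF ?hK ?hL ?halg ?hadd ?hmul (Uq.mem_levi_univ X)
  case hE =>
    intro i _
    rw [adT_E, Uq.counit_E, ← (hK i).eq, mul_assoc M, ← mul_assoc (fundK N q i), h.K_E, A_self, hE,
      mul_smul_comm]
    simp
  case hF =>
    intro i _
    rw [adT_F, Uq.counit_F, hF, h.KF, A_self]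
    simp [mul_assoc]
  case hK =>
    intro i
    rw [adT_K, Uq.counit_K, ← (hK i).eq, mul_assoc, fundK_mul_fundKinv]; simp
  case hL =>
    intro i
    rw [adT_Kinv, Uq.counit_L, mul_assoc, (hK i).eq, ← mul_assoc, fundKinv_mul_fundK]; simp
  case halg =>
    intro c
    rw [adT_algebraMap, Bialgebra.counit_algebraMap]
  case hadd =>
    intro X Y hX hY
    rw [map_add, map_add, hX, hY, add_smul]
  case hmul =>
    intro X Y hX hY
    rw [adT_mul, hY, adT, LinearMap.comp_apply, sandwich_smul, ← LinearMap.comp_apply, ← adT, hX,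
      smul_smul, Bialgebra.counit_mul, mul_comm]

-- The map `X ↦ S(X)*` is multiplicative and conjugate-linear and exchanges `E_i` with `-F_i` and
-- `K_i` with its inverse, so the claim propagates from generators when `M` is kept arbitrary. It is
-- the source of `P* = P`.
open Matrix in
theorem adR_conjTranspose (M : Matrix (Fin N) (Fin N) ℂ) (X : Uq N q) :
    (adR N q M (Uq.starMap (Uq.S N q X)))ᴴ = adR N q Mᴴ X := by
  have h := fund_qrel N q Fact.out Fact.out
  have hEs : ∀ i, (fundE N q i)ᴴ = fundK N q i * fundF N q i := fun i => by
    rw [← fundRep_E, ← fundRep_starMap, Uq.starMap_E]; simp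
  have hFs : ∀ i, (fundF N q i)ᴴ = fundE N q i * fundKinv N q i := fun i => by
    rw [← fundRep_F, ← fundRep_starMap, Uq.starMap_F]; simp
  have hKs : ∀ i, (fundK N q i)ᴴ = fundK N q i := fun i => by
    rw [← fundRep_K, ← fundRep_starMap, Uq.starMap_K]
  have hLs : ∀ i, (fundKinv N q i)ᴴ = fundKinv N q i := fun i => by
    rw [← fundRep_Kinv, ← fundRep_starMap, Uq.starMap_Kinv]
  revert M
  refine Uq.levi_induction (p := fun X => ∀ M, (adR N q M (Uq.starMap (Uq.S N q X)))ᴴ = adR N q Mᴴ X)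
    ?hE ?hF ?hK ?hL ?halg ?hadd ?hmul (Uq.mem_levi_univ X)
  case hE =>
    intro i _ M
    have e : Uq.starMap (Uq.S N q (Uq.E i)) = -Uq.F i := by
      rw [Uq.S_E, Uq.starMap_neg, Uq.starMap_mul, Uq.starMap_E, Uq.starMap_Kinv, ← mul_assoc,
        (Uq.qrel N q).L_mul_K, one_mul]
    rw [e, map_neg, adR_F, adR_E]
    simp only [conjTranspose_neg, conjTranspose_add, conjTranspose_mul, hFs, hKs, mul_assoc,
      fundKinv_mul_fundK, neg_mul, mul_one]
    simp [add_comm]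
  case hF =>
    intro i _ M
    have e : Uq.starMap (Uq.S N q (Uq.F i)) = -Uq.E i := by
      rw [Uq.S_F, Uq.starMap_neg, Uq.starMap_mul, Uq.starMap_F, Uq.starMap_K, mul_assoc,
        (Uq.qrel N q).L_mul_K, mul_one]
    rw [e, map_neg, adR_F, adR_E]
    simp only [conjTranspose_neg, conjTranspose_add, conjTranspose_mul, hEs, hKs, hLs, mul_assoc,
      neg_mul]
    rw [← mul_assoc (fundKinv N q i), fundKinv_mul_fundK, one_mul]
    simp [add_comm]
  case hK =>
    intro i M
    rw [Uq.S_K, Uq.starMap_Kinv, adR_K, adR_Kinv]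
    simp [hKs, hLs, mul_assoc]
  case hL =>
    intro i M
    rw [Uq.S_Kinv, Uq.starMap_K, adR_K, adR_Kinv]
    simp [hKs, hLs, mul_assoc]
  case halg =>
    intro c M
    rw [Uq.S_algebraMap, Uq.starMap_algebraMap, adR_algebraMap, adR_algebraMap]
    simp
  case hadd =>
    intro X Y hX hY M
    rw [map_add, Uq.starMap_add, map_add, conjTranspose_add, hX, hY, map_add]
  case hmul =>
    intro X Y hX hY M
    rw [Uq.S_mul, Uq.starMap_mul, adR_mul, hY, hX, adR_mul]

end sandwich

/-! ### The weights of `K_(2ρ)` in the fundamental representation -/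

section weights
variable {N : ℕ} {q : ℝ} [Fact (0 < q)] [Fact (q ≠ 1)]

theorem fundRep_kUnit_zpow (i : Fin (N - 1)) (n : ℤ) :
    fundRep N q ((Uq.kUnit i ^ n : (Uq N q)ˣ) : Uq N q) =
      Matrix.diagonal fun m => (q : ℂ) ^ (n * fundWeight i m) := by
  have hq : (q : ℂ) ≠ 0 := Uq.q_ne_zero Fact.out
  have hK : fundRep N q ((Uq.kUnit i : (Uq N q)ˣ) : Uq N q) = fundK N q i := fundRep_K i
  have hL : fundRep N q (((Uq.kUnit i)⁻¹ : (Uq N q)ˣ) : Uq N q) = fundKinv N q i := fundRep_Kinv i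
  cases n with
  | ofNat n =>
    rw [Int.ofNat_eq_natCast, zpow_natCast, Units.val_pow_eq_pow_val, map_pow, hK, fundK,
      Matrix.diagonal_pow]
    congr 1
    funext m
    rw [Pi.pow_apply, mul_comm, zpow_mul, zpow_natCast]
  | negSucc n =>
    rw [zpow_negSucc, ← inv_pow, Units.val_pow_eq_pow_val, map_pow, hL, fundKinv,
      Matrix.diagonal_pow]
    congr 1
    funext m
    rw [Pi.pow_apply, ← zpow_natCast, ← zpow_mul]
    congr 1
    rw [Int.negSucc_eq]; push_cast; ring

theorem fundRep_kLam (lam : Fin (N - 1) → ℤ) :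
    fundRep N q (Uq.kLam N q lam : Uq N q) =
      Matrix.diagonal fun m => (q : ℂ) ^ (∑ i, lam i * fundWeight i m) := by
  have hq : (q : ℂ) ≠ 0 := Uq.q_ne_zero Fact.out
  have key : ∀ l : List (Fin (N - 1)),
      fundRep N q (((l.map fun i => Uq.kUnit i ^ lam i).prod : (Uq N q)ˣ) : Uq N q) =
        Matrix.diagonal fun m => (q : ℂ) ^ ((l.map fun i => lam i * fundWeight i m).sum) := by
    intro l
    induction l with
    | nil => simp
    | cons i l ih =>
      rw [List.map_cons, List.prod_cons, Units.val_mul, map_mul, ih, fundRep_kUnit_zpow,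
        Matrix.diagonal_mul_diagonal]
      congr 1
      funext m
      rw [List.map_cons, List.sum_cons, zpow_add₀ hq]
  rw [Uq.kLam, key]
  simp only [Fin.sum_univ_def]

/-- At most two simple roots pair non-trivially with a given weight, leaving `(m+1)(N-m-1) - m(N-m)`
for the zero-based index `m`. -/
theorem sum_twoRho_mul_fundWeight (m : Fin N) :
    ∑ i, Uq.twoRho N i * fundWeight i m = (N : ℤ) - 1 - 2 * m := by
  have h1 : ∑ i : Fin (N - 1), Uq.twoRho N i * (if (m : ℕ) = i then 1 else 0) =
      ((m : ℤ) + 1) * (N - (m + 1)) := by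
    by_cases h : (m : ℕ) < N - 1
    · rw [Finset.sum_eq_single ⟨m, h⟩]
      · simp [Uq.twoRho]
      · intro b _ hb
        rw [if_neg (fun h' => hb (Fin.ext h'.symm)), mul_zero]
      · simp
    -- For the last basis vector no simple root occurs in this sum, but the closed formula vanishes
    -- as well. The same happens for the first basis vector in `h2`.
    · have hm : (m : ℤ) + 1 = N := by have := m.2; omega
      rw [hm, sub_self, mul_zero]
      refine Finset.sum_eq_zero fun i _ => ?_
      rw [if_neg (by have := i.2; omega), mul_zero]
  have h2 : ∑ i : Fin (N - 1), Uq.twoRho N i * (if (m : ℕ) = i + 1 then 1 else 0) =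
      (m : ℤ) * (N - m) := by
    by_cases h : (m : ℕ) = 0
    · rw [h, Nat.cast_zero, zero_mul]
      refine Finset.sum_eq_zero fun i _ => ?_
      rw [if_neg (by omega), mul_zero]
    · have hm := m.2
      rw [Finset.sum_eq_single ⟨m - 1, by omega⟩]
      · simp only [Uq.twoRho]
        rw [if_pos (by omega)]
        push_cast [Nat.one_le_iff_ne_zero.2 h]
        ring
      · intro b _ hb
        rw [if_neg (fun h' => hb (Fin.ext (by simp only; omega))), mul_zero]
      · simp
  simp only [fundWeight, mul_sub, Finset.sum_sub_distrib, h1, h2]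
  ring

theorem fundRep_kLam_twoRho : fundRep N q (Uq.kLam N q (Uq.twoRho N) : Uq N q) =
    Matrix.diagonal fun m : Fin N => (q : ℂ) ^ ((N : ℤ) - 1 - 2 * m) := by
  rw [fundRep_kLam]
  simp only [sum_twoRho_mul_fundWeight]

theorem rhoInv_eq : rhoInv N q = Matrix.diagonal fun m : Fin N =>
    (q : ℂ) ^ (2 * (m : ℤ) + 1 - N) := by
  have hq : (q : ℂ) ≠ 0 := Uq.q_ne_zero Fact.out
  have h1 : rhoInv N q * fundRep N q (Uq.kLam N q (Uq.twoRho N) : Uq N q) = 1 := by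
    rw [rhoInv, ← map_mul, Units.inv_mul, map_one]
  refine left_inv_eq_right_inv h1 ?_
  rw [fundRep_kLam_twoRho, Matrix.diagonal_mul_diagonal, ← Matrix.diagonal_one]
  congr 1
  funext m
  rw [← zpow_add₀ hq, ← zpow_zero (q : ℂ)]
  congr 1
  ring

omit [Fact (0 < q)] [Fact (q ≠ 1)] in
theorem commute_diagonal_fundK (d : Fin N → ℂ) (i : Fin (N - 1)) :
    Commute (Matrix.diagonal d) (fundK N q i) := by
  rw [Commute, SemiconjBy, fundK, Matrix.diagonal_mul_diagonal, Matrix.diagonal_mul_diagonal]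
  simp only [mul_comm]

/-- Consecutive diagonal entries of `V` have ratio `q²`, exactly the scalar by which `S²` acts on
`E_i`. This is the mechanism behind the quantum trace. -/
theorem adT_rhoInv (X : Uq N q) :
    adT N q (rhoInv N q) X = Coalgebra.counit (R := ℂ) X • rhoInv N q := by
  have hq : (q : ℂ) ≠ 0 := Uq.q_ne_zero Fact.out
  rw [rhoInv_eq]
  refine adT_invariant (fun i => commute_diagonal_fundK _ i) (fun i => ?_) (fun i => ?_) X
  · ext a b
    simp only [fundE, Matrix.mul_diagonal, Matrix.smul_apply, Matrix.diagonal_mul,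
      Matrix.single_apply, Fin.ext_iff, smul_eq_mul]
    split_ifs with h
    · rw [← h.1, ← h.2, ← mul_assoc, ← zpow_add₀ hq, mul_comm]
      congr 2
      push_cast; ring
    · simp
  · ext a b
    simp only [fundF, Matrix.mul_diagonal, Matrix.smul_apply, Matrix.diagonal_mul,
      Matrix.single_apply, Fin.ext_iff, smul_eq_mul]
    split_ifs with h
    · rw [← h.1, ← h.2, ← mul_assoc, ← zpow_add₀ hq, mul_comm]
      congr 2
      push_cast; ring
    · simp

end weights

/-! ### The matrix `P` as the orbit of the coordinate projection -/

section projection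
variable {N : ℕ} {q : ℝ} [Fact (0 < q)] [Fact (q ≠ 1)]

/-- The projection of `ℂ^N` onto the span of the first `r` basis vectors. -/
def coordProj (r N : ℕ) : Matrix (Fin N) (Fin N) ℂ :=
  Matrix.diagonal fun m => if (m : ℕ) < r then 1 else 0

omit [Fact (0 < q)] [Fact (q ≠ 1)] in
theorem coordProj_fundE {r : ℕ} (i : Fin (N - 1)) : coordProj r N * fundE N q i =
    if (i : ℕ) < r then fundE N q i else 0 := by
  ext a b
  simp only [coordProj, fundE, Matrix.diagonal_mul, Matrix.single_apply, Fin.ext_iff]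
  split_ifs <;> grind [Matrix.zero_apply]

omit [Fact (0 < q)] [Fact (q ≠ 1)] in
theorem fundE_coordProj {r : ℕ} (i : Fin (N - 1)) : fundE N q i * coordProj r N =
    if (i : ℕ) + 1 < r then fundE N q i else 0 := by
  ext a b
  simp only [coordProj, fundE, Matrix.mul_diagonal, Matrix.single_apply, Fin.ext_iff]
  split_ifs <;> grind [Matrix.zero_apply]

omit [Fact (0 < q)] [Fact (q ≠ 1)] in
theorem coordProj_fundF {r : ℕ} (i : Fin (N - 1)) : coordProj r N * fundF N q i =
    if (i : ℕ) + 1 < r then fundF N q i else 0 := by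
  ext a b
  simp only [coordProj, fundF, Matrix.diagonal_mul, Matrix.single_apply, Fin.ext_iff]
  split_ifs <;> grind [Matrix.zero_apply]

omit [Fact (0 < q)] [Fact (q ≠ 1)] in
theorem fundF_coordProj {r : ℕ} (i : Fin (N - 1)) : fundF N q i * coordProj r N =
    if (i : ℕ) < r then fundF N q i else 0 := by
  ext a b
  simp only [coordProj, fundF, Matrix.mul_diagonal, Matrix.single_apply, Fin.ext_iff]
  split_ifs <;> grind [Matrix.zero_apply]

-- The left and right products with the projection are governed by the conditions `i < r` and `i + 1
-- < r`, which differ only for the omitted root `i + 1 = r`.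
omit [Fact (0 < q)] [Fact (q ≠ 1)] in
theorem commute_coordProj_fundE {r : ℕ} {i : Fin (N - 1)} (hi : (i : ℕ) + 1 ≠ r) :
    Commute (coordProj r N) (fundE N q i) := by
  rw [Commute, SemiconjBy, coordProj_fundE, fundE_coordProj]
  grind

omit [Fact (0 < q)] [Fact (q ≠ 1)] in
theorem commute_coordProj_fundF {r : ℕ} {i : Fin (N - 1)} (hi : (i : ℕ) + 1 ≠ r) :
    Commute (coordProj r N) (fundF N q i) := by
  rw [Commute, SemiconjBy, coordProj_fundF, fundF_coordProj]
  grind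

theorem adR_coordProj {r : ℕ} {X : Uq N q} (hX : X ∈ Uq.levi N q {k | (k : ℕ) + 1 ≠ r}) :
    adR N q (coordProj r N) X = Coalgebra.counit (R := ℂ) X • coordProj r N :=
  adR_invariant (fun i => commute_diagonal_fundK _ i) (fun _ hi => commute_coordProj_fundE hi)
    (fun _ hi => commute_coordProj_fundF hi) hX

theorem adL_coordProj {r : ℕ} {X : Uq N q} (hX : X ∈ Uq.levi N q {k | (k : ℕ) + 1 ≠ r}) :
    adL N q (coordProj r N) X = Coalgebra.counit (R := ℂ) X • coordProj r N :=
  adL_invariant (fun i => commute_diagonal_fundK _ i) (fun _ hi => commute_coordProj_fundE hi)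
    (fun _ hi => commute_coordProj_fundF hi) hX

/-- This is the antipode axiom `X₁ S(X₂) = ε(X)` seen in the fundamental representation, obtained
here as invariance of the identity matrix. -/
theorem adL_one (X : Uq N q) : adL N q 1 X = Coalgebra.counit (R := ℂ) X • 1 :=
  adL_invariant (fun _ => Commute.one_left _) (fun _ _ => Commute.one_left _)
    (fun _ _ => Commute.one_left _) (Uq.mem_levi_univ X)

/-- `v ⊗ f ↦ v f`, the identification of `V ⊗ V*` with the square matrices. -/
def tensorToMatrix (N : ℕ) :
    ((Fin N → ℂ) ⊗[ℂ] Module.Dual ℂ (Fin N → ℂ)) ≃ₗ[ℂ] Matrix (Fin N) (Fin N) ℂ :=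
  TensorProduct.comm ℂ _ _ ≪≫ₗ dualTensorHomEquiv ℂ (Fin N → ℂ) (Fin N → ℂ) ≪≫ₗ LinearMap.toMatrix'

/-- Under `V ⊗ V* ≅ End V`, acting on the vector multiplies by `π(X₁)` on the left and acting on the
functional multiplies by `π(S(X₂))` on the right. The invariance of `w` thus becomes that of the
coordinate projection. -/
theorem tensorToMatrix_tensorAct (X : Uq N q) (t) :
    tensorToMatrix N (tensorAct N q X t) = adL N q (tensorToMatrix N t) X := by
  rw [tensorAct, adL, LinearMap.comp_apply]
  generalize Coalgebra.comul (R := ℂ) X = z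
  induction z using TensorProduct.induction_on with
  | zero => simp
  | add x y hx hy => simp only [map_add, LinearMap.add_apply, hx, hy]
  | tmul a b =>
    rw [sandwich_tmul]
    induction t using TensorProduct.induction_on with
    | zero => simp
    | add x y hx hy => simp only [map_add, mul_add, add_mul, hx, hy]
    | tmul v f =>
      have : dualTensorHom ℂ (Fin N → ℂ) (Fin N → ℂ) ((dualVAct N q b f) ⊗ₜ (vAct N q a v)) =
          Matrix.toLin' (fundRep N q a) ∘ₗ dualTensorHom ℂ _ _ (f ⊗ₜ v) ∘ₗ
            Matrix.toLin' (fundS N q b) := by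
        ext i : 2
        simp [dualVAct, vAct, fundS_apply, Module.Dual.transpose_apply]
      have hd : ∀ t, dualTensorHomEquiv ℂ (Fin N → ℂ) (Fin N → ℂ) t = dualTensorHom ℂ _ _ t :=
        fun t => by simp [dualTensorHomEquiv]
      simp only [TensorProduct.map_tmul, TensorProduct.homTensorHomMap_apply, tensorToMatrix,
        LinearEquiv.trans_apply, TensorProduct.comm_tmul, hd, this,
        LinearMap.toMatrix'_comp, LinearMap.toMatrix'_toLin', AlgHom.toLinearMap_apply, mul_assoc]

theorem tensorToMatrix_invVec (r N : ℕ) : tensorToMatrix N (invVec r N) = coordProj r N := by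
  ext a b
  rw [invVec, map_sum, Matrix.sum_apply, coordProj, Matrix.diagonal_apply, Finset.sum_filter,
    Finset.sum_eq_single a]
  · simp [tensorToMatrix, LinearMap.toMatrix'_apply, Pi.single_apply, ← ite_and, and_comm]
  · intro m _ hm
    simp [tensorToMatrix, LinearMap.toMatrix'_apply, hm.symm]
  · simp

theorem tensorAct_invVec {r : ℕ} {X : Uq N q} (hX : X ∈ Uq.levi N q {k | (k : ℕ) + 1 ≠ r}) :
    tensorAct N q X (invVec r N) = Coalgebra.counit (R := ℂ) X • invVec r N := by
  apply (tensorToMatrix N).injective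
  rw [tensorToMatrix_tensorAct, map_smul, tensorToMatrix_invVec, adL_coordProj hX]

/-- The matrix `(u^i_j)`. -/
def uMat (N : ℕ) (q : ℝ) [Fact (0 < q)] [Fact (q ≠ 1)] : Matrix (Fin N) (Fin N) (UqDual N q) :=
  Matrix.of (u N q)

/-- The adjoint of the matrix `(u^i_j)`. -/
def uMatStar (N : ℕ) (q : ℝ) [Fact (0 < q)] [Fact (q ≠ 1)] :
    Matrix (Fin N) (Fin N) (UqDual N q) :=
  Matrix.of fun i j => dualStar (u N q j i)

/-- Half of the unitarity of the fundamental corepresentation; this half is all that `P² = P`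
requires. -/
theorem uMat_mul_uMatStar : uMat N q * uMatStar N q = 1 := by
  ext i j X
  have h : (uMat N q * uMatStar N q) i j X = adL N q 1 X i j := by
    rw [Matrix.mul_apply, adL, LinearMap.comp_apply]
    simp only [WithConv.ofConv_sum, LinearMap.sum_apply, mul_apply']
    generalize Coalgebra.comul (R := ℂ) X = z
    induction z using TensorProduct.induction_on with
    | zero => simp
    | add x y hx hy => simp only [map_add, Finset.sum_add_distrib, hx, hy, Matrix.add_apply]
    | tmul a b =>
      rw [sandwich_tmul, mul_one, Matrix.mul_apply]
      refine Finset.sum_congr rfl fun k _ => ?_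
      rw [TensorProduct.map_tmul, LinearMap.mul'_apply]
      exact congrArg (fundRep N q a i k * ·) (dualStar_u_apply j k b)
  rw [h, adL_one]
  by_cases hij : i = j
  · subst hij; simp
  · simp [hij]

theorem projP_eq_mul (r : ℕ) : projP r N q =
    uMatStar N q * Matrix.diagonal (fun m : Fin N => if (m : ℕ) < r then 1 else 0) * uMat N q := by
  ext1 i j
  rw [projP, Matrix.sum_apply, Matrix.mul_apply, Finset.sum_filter]
  refine Finset.sum_congr rfl fun m _ => ?_
  rw [Matrix.mul_diagonal]
  split_ifs <;> simp [unitM, uMat, uMatStar]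

theorem projP_mul_projP (r : ℕ) : projP r N q * projP r N q = projP r N q := by
  rw [projP_eq_mul]
  simp only [mul_assoc]
  rw [← mul_assoc (uMat N q), uMat_mul_uMatStar, one_mul, ← mul_assoc (Matrix.diagonal _),
    Matrix.diagonal_mul_diagonal]
  simp [← ite_and]

/-- The bridge from functionals to matrices: membership in the Grassmannian, self-adjointness, the
trace and the behaviour under `θ` are all read off from `adR`. -/
theorem projP_apply (r : ℕ) (i j : Fin N) (X : Uq N q) :
    projP r N q i j X = adR N q (coordProj r N) X i j := by
  rw [projP, Matrix.sum_apply, adR, LinearMap.comp_apply]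
  simp only [WithConv.ofConv_sum, LinearMap.sum_apply, unitM, Matrix.of_apply, mul_apply']
  generalize Coalgebra.comul (R := ℂ) X = z
  induction z using TensorProduct.induction_on with
  | zero => simp
  | add x y hx hy => simp only [map_add, Finset.sum_add_distrib, hx, hy, Matrix.add_apply]
  | tmul a b =>
    rw [sandwich_tmul, Matrix.mul_apply, Finset.sum_filter]
    refine Finset.sum_congr rfl fun k _ => ?_
    rw [TensorProduct.map_tmul, LinearMap.mul'_apply, coordProj, Matrix.mul_diagonal]
    split_ifs
    · rw [mul_one]
      exact congrArg (· * fundRep N q b k j) (dualStar_u_apply k i a)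
    · simp

theorem u_mem_Cq (i j : Fin N) : u N q i j ∈ Cq N q :=
  Submodule.subset_span ⟨N, fundRep N q, i, j,
    fun k => ⟨1, 1, fundWeight k, mul_one 1, by simp [fundK]⟩, rfl⟩

/-- The contragredient of the fundamental representation. -/
def contraRep (N : ℕ) (q : ℝ) [Fact (0 < q)] [Fact (q ≠ 1)] :
    Uq N q →ₐ[ℂ] Matrix (Fin N) (Fin N) ℂ :=
  AlgHom.ofLinearMap ((Matrix.transposeLinearEquiv _ _ ℂ ℂ).toLinearMap ∘ₗ fundS N q)
    (by simp) (fun X Y => by simp [fundS_mul])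

theorem dualStar_u_mem_Cq (i j : Fin N) : dualStar (u N q i j) ∈ Cq N q := by
  refine Submodule.subset_span ⟨N, contraRep N q, i, j, fun k => ⟨1, 1, fun m => -fundWeight k m,
    mul_one 1, ?_⟩, ?_⟩
  · simp [contraRep, fundKinv]
  · ext X
    exact dualStar_u_apply i j X

/-- As `adR` is a right action, multiplying the argument by `X` on the left lets `X` act first,
directly on the coordinate projection, which is invariant under the Levi factor. -/
theorem projP_mem_flag (r : ℕ) (i j : Fin N) :
    projP r N q i j ∈ flag N q {k | (k : ℕ) + 1 ≠ r} := by
  refine ⟨?_, fun X hX => ?_⟩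
  · rw [projP, Matrix.sum_apply]
    exact Subalgebra.sum_mem _ fun m _ => mul_mem (dualStar_u_mem_Cq _ _) (u_mem_Cq _ _)
  · ext Y
    change projP r N q i j (X * Y) = Coalgebra.counit (R := ℂ) X * projP r N q i j Y
    rw [projP_apply, projP_apply, adR_mul, adR_coordProj hX, adR, LinearMap.comp_apply,
      sandwich_smul]
    rfl

theorem dualStar_projP (r : ℕ) (i j : Fin N) :
    dualStar (projP r N q j i) = projP r N q i j := by
  have hp : (coordProj r N).conjTranspose = coordProj r N := by
    rw [coordProj, Matrix.diagonal_conjTranspose]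
    congr 1; funext m
    simp only [Pi.star_apply]
    split_ifs <;> simp
  ext X
  change starRingEnd ℂ (projP r N q j i _) = _
  rw [projP_apply, projP_apply]
  nth_rewrite 2 [← hp]
  rw [← adR_conjTranspose]
  rfl

/-- Cyclicity of the trace moves the action from the projection to `V`: `Tr(V π(S(X₁)) p π(X₂)) =
Tr(p π(X₂) V π(S(X₁)))`. There `adT_rhoInv` applies. -/
theorem sum_rhoInv_projP (r : ℕ) (X : Uq N q) :
    Matrix.trace (rhoInv N q * adR N q (coordProj r N) X) =
      Coalgebra.counit (R := ℂ) X * Matrix.trace (coordProj r N * rhoInv N q) := by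
  have h : Matrix.trace (rhoInv N q * adR N q (coordProj r N) X) =
      Matrix.trace (coordProj r N * adT N q (rhoInv N q) X) := by
    rw [adR, adT, LinearMap.comp_apply, LinearMap.comp_apply, LinearMap.comp_apply]
    generalize Coalgebra.comul (R := ℂ) X = z
    induction z using TensorProduct.induction_on with
    | zero => simp
    | add x y hx hy => simp only [map_add, mul_add, Matrix.trace_add, hx, hy]
    | tmul a b =>
      rw [LinearEquiv.coe_coe, TensorProduct.comm_tmul, sandwich_tmul, sandwich_tmul,
        Matrix.trace_mul_comm, mul_assoc, mul_assoc, Matrix.trace_mul_comm]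
      simp only [mul_assoc]
  rw [h, adT_rhoInv, mul_smul_comm, Matrix.trace_smul, smul_eq_mul]

theorem trace_coordProj_rhoInv {r : ℕ} (hrN : r ≤ N) :
    Matrix.trace (coordProj r N * rhoInv N q) =
      (q : ℂ) ^ ((r : ℤ) - (N : ℤ)) * (qInt q r : ℂ) := by
  have hq' : 0 < q := Fact.out
  have hq1 : q ≠ 1 := Fact.out
  have hq : (q : ℂ) ≠ 0 := Uq.q_ne_zero Fact.out
  have hqq : (q : ℂ) - (q : ℂ)⁻¹ ≠ 0 := by
    have : q - q⁻¹ ≠ 0 := by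
      intro h
      have h2 : q * q = 1 := by
        field_simp at h
        nlinarith
      have : (q - 1) * (q + 1) = 0 := by linear_combination h2
      rcases mul_eq_zero.1 this with h | h
      · exact hq1 (by linarith)
      · linarith
    exact_mod_cast this
  have h1 : Matrix.trace (coordProj r N * rhoInv N q) =
      ∑ m ∈ Finset.range r, (q : ℂ) ^ (2 * (m : ℤ) + 1 - N) := by
    rw [coordProj, rhoInv_eq, Matrix.diagonal_mul_diagonal, Matrix.trace_diagonal,
      Fin.sum_univ_eq_sum_range
        (fun m : ℕ => (if m < r then 1 else 0) * (q : ℂ) ^ (2 * (m : ℤ) + 1 - N)) N,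
      ← Finset.sum_subset (Finset.range_mono hrN)]
    · exact Finset.sum_congr rfl fun m hm => by rw [if_pos (Finset.mem_range.1 hm), one_mul]
    · intro m _ hm
      rw [if_neg (fun h => hm (Finset.mem_range.2 h)), zero_mul]
  rw [h1, qInt]
  clear h1 hrN
  push_cast
  rw [mul_div_assoc', eq_div_iff hqq]
  -- Geometric sum `∑ q^(2m+1-N)` over `m < r`, after clearing the denominator `q - q⁻¹`; the bound
  -- on `r` was dropped so that the induction runs over all `r`.
  induction r with
  | zero => simp
  | succ r ih =>
    rw [Finset.sum_range_succ, add_mul, ih]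
    have e1 : (q : ℂ) ^ (((r + 1 : ℕ) : ℤ) - N) = q ^ r * q * ((q : ℂ) ^ N)⁻¹ := by
      rw [zpow_sub₀ hq, zpow_natCast, zpow_natCast, pow_succ, div_eq_mul_inv]
    have e2 : (q : ℂ) ^ ((r : ℤ) - N) = q ^ r * ((q : ℂ) ^ N)⁻¹ := by
      rw [zpow_sub₀ hq, zpow_natCast, zpow_natCast, div_eq_mul_inv]
    have e3 : (q : ℂ) ^ (2 * (r : ℤ) + 1 - N) = q ^ r * q ^ r * q * ((q : ℂ) ^ N)⁻¹ := by
      rw [zpow_sub₀ hq, zpow_add₀ hq, zpow_one, zpow_natCast, two_mul, zpow_add₀ hq,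
        zpow_natCast, div_eq_mul_inv]
    rw [e1, e2, e3, pow_succ, pow_succ, inv_pow]
    field_simp
    ring

end projection

/-! ### The quantum Grassmannian: base point, tangent derivations and the pairing -/

section grassmannian
variable {r N : ℕ} {q : ℝ} [Fact (0 < q)]

theorem Gr.incl_injective : Function.Injective (Gr.incl r N q) := Subtype.val_injective

theorem Gr.incl_levi_mul (a : Gr r N q) {X : Uq N q}
    (hX : X ∈ Uq.levi N q {k | (k : ℕ) + 1 ≠ r}) (Y : Uq N q) :
    Gr.incl r N q a (X * Y) = Coalgebra.counit (R := ℂ) X * Gr.incl r N q a Y :=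
  congrArg (fun φ : UqDual N q => φ Y) (a.2.2 X hX)

theorem Gr.incl_levi (a : Gr r N q) {X : Uq N q}
    (hX : X ∈ Uq.levi N q {k | (k : ℕ) + 1 ≠ r}) :
    Gr.incl r N q a X = Coalgebra.counit (R := ℂ) X * Gr.incl r N q a 1 := by
  rw [← Gr.incl_levi_mul a hX, mul_one]

/-- Of the two translations in `θ`, the one by `K_(2ρ)` from the left is trivial because `K_(2ρ)`
lies in the Levi factor. At `X = 1` the other one is trivial too, which makes the base point
`θ`-invariant. -/
theorem Gr.incl_grModular (a : Gr r N q) (X : Uq N q) :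
    Gr.incl r N q (grModular r N q a) X =
      Gr.incl r N q a (X * Uq.kLam N q (Uq.twoRho N)) := by
  have h : Gr.incl r N q (grModular r N q a) X =
      Gr.incl r N q a (Uq.kLam N q (Uq.twoRho N) * (X * Uq.kLam N q (Uq.twoRho N))) := rfl
  rw [h, Gr.incl_levi_mul a (Uq.kLam_mem_levi _ _), Uq.counit_kLam, one_mul]

/-- Evaluation of an element of the Grassmannian, as a functional on `U_q(sl(N))`. -/
def Gr.eval (r : ℕ) (X : Uq N q) : Gr r N q →ₗ[ℂ] ℂ where
  toFun a := Gr.incl r N q a X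
  map_add' a b := by rw [map_add]; rfl
  map_smul' c a := by rw [map_smul]; rfl

theorem Gr.eval_apply (X : Uq N q) (a : Gr r N q) : Gr.eval r X a = Gr.incl r N q a X := rfl

theorem Gr.eval_ext {a b : Gr r N q} (h : ∀ X, Gr.eval r X a = Gr.eval r X b) : a = b :=
  Gr.incl_injective (by ext X; exact h X)

theorem Gr.eval_algebraMap (X : Uq N q) (c : ℂ) :
    Gr.eval r X (algebraMap ℂ _ c) = c * Coalgebra.counit (R := ℂ) X := by
  rw [Gr.eval_apply, AlgHom.commutes]
  simp

theorem Gr.eval_one_mul (a b : Gr r N q) : Gr.eval r 1 (a * b) = Gr.eval r 1 a * Gr.eval r 1 b := by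
  simp only [Gr.eval_apply, map_mul]
  rw [mul_apply', Bialgebra.comul_one, Algebra.TensorProduct.one_def]
  rfl

/-- A skew-primitive element becomes primitive at the base point: in `E_i ⊗ K_i + 1 ⊗ E_i` the
factor `K_i` is evaluated by the counit. Likewise for `K_i⁻¹` in the coproduct of `F_i`. Only `i + 1
= r` can give a non-zero derivation, the other generators being in the Levi factor. -/
theorem Gr.eval_E_mul (i : Fin (N - 1)) (a b : Gr r N q) : Gr.eval r (Uq.E i) (a * b) =
    Gr.eval r (Uq.E i) a * Gr.eval r 1 b + Gr.eval r 1 a * Gr.eval r (Uq.E i) b := by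
  have hK : (Uq.K i : Uq N q) ∈ Uq.levi N q {k | (k : ℕ) + 1 ≠ r} := by
    have := Uq.kLam_mem_levi (q := q) {k | (k : ℕ) + 1 ≠ r} (Pi.single i 1)
    rwa [Uq.kLam_single, zpow_one] at this
  simp only [Gr.eval_apply, map_mul]
  rw [mul_apply', Uq.comul_E, map_add, map_add, TensorProduct.map_tmul, TensorProduct.map_tmul,
    LinearMap.mul'_apply, LinearMap.mul'_apply, Gr.incl_levi b hK, Uq.counit_K, one_mul]

theorem Gr.eval_F_mul (i : Fin (N - 1)) (a b : Gr r N q) : Gr.eval r (Uq.F i) (a * b) =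
    Gr.eval r (Uq.F i) a * Gr.eval r 1 b + Gr.eval r 1 a * Gr.eval r (Uq.F i) b := by
  have hK : (Uq.Kinv i : Uq N q) ∈ Uq.levi N q {k | (k : ℕ) + 1 ≠ r} := by
    have := Uq.kLam_mem_levi (q := q) {k | (k : ℕ) + 1 ≠ r} (Pi.single i (-1))
    rwa [Uq.kLam_single, zpow_neg_one] at this
  simp only [Gr.eval_apply, map_mul]
  rw [mul_apply', Uq.comul_F, map_add, map_add, TensorProduct.map_tmul, TensorProduct.map_tmul,
    LinearMap.mul'_apply, LinearMap.mul'_apply, Gr.incl_levi a hK, Uq.counit_L, one_mul]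

variable [Fact (q ≠ 1)]

/-- The projection `P` over the coordinate ring of the quantum Grassmannian. -/
def grProj (r N : ℕ) (q : ℝ) [Fact (0 < q)] [Fact (q ≠ 1)] :
    Matrix (Fin N) (Fin N) (Gr r N q) :=
  Matrix.of fun i j => ⟨projP r N q i j, projP_mem_flag r i j⟩

theorem incl_grProj (i j : Fin N) : Gr.incl r N q (grProj r N q i j) = projP r N q i j := rfl

theorem eval_grProj (X : Uq N q) (i j : Fin N) :
    Gr.eval r X (grProj r N q i j) = adR N q (coordProj r N) X i j :=
  projP_apply r i j X

theorem grProj_mul_grProj : grProj r N q * grProj r N q = grProj r N q := by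
  ext1 i j
  apply Gr.incl_injective
  rw [Matrix.mul_apply, map_sum, incl_grProj]
  simp only [map_mul, incl_grProj]
  rw [← Matrix.mul_apply, projP_mul_projP]

theorem trace_rhoInv_mul_grProj (hrN : r ≤ N) :
    Matrix.trace ((rhoInv N q).map (algebraMap ℂ (Gr r N q)) * grProj r N q) =
      algebraMap ℂ (Gr r N q) ((q : ℂ) ^ ((r : ℤ) - (N : ℤ)) * (qInt q r : ℂ)) := by
  refine Gr.eval_ext fun X => ?_
  rw [Gr.eval_algebraMap, ← trace_coordProj_rhoInv hrN, mul_comm, ← sum_rhoInv_projP]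
  simp only [Matrix.trace, Matrix.diag, Matrix.mul_apply, map_sum, Matrix.map_apply,
    ← Algebra.smul_def, map_smul, eval_grProj, smul_eq_mul]

/-- Evaluating at `X K_(2ρ)` conjugates the value of `P` at `X`, since `K_(2ρ)` is group-like: `θ(P)
= π(S(K_(2ρ))) P π(K_(2ρ)) = V P V⁻¹`. -/
theorem grModular_grProj_mul_rhoInv :
    (grProj r N q).map (grModular r N q) * (rhoInv N q).map (algebraMap ℂ (Gr r N q)) =
      (rhoInv N q).map (algebraMap ℂ (Gr r N q)) * grProj r N q := by
  have hS : fundS N q (Uq.kLam N q (Uq.twoRho N)) = rhoInv N q := by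
    have h1 : fundRep N q (Uq.kLam N q (Uq.twoRho N) : Uq N q) *
        fundS N q (Uq.kLam N q (Uq.twoRho N)) = 1 := by
      -- On a group-like element `adL_one` says that `π(S(K_(2ρ)))` is inverse to `π(K_(2ρ))`.
      have := adL_one (q := q) (Uq.kLam N q (Uq.twoRho N) : Uq N q)
      rwa [adL, LinearMap.comp_apply, Uq.comul_kLam, sandwich_tmul, Uq.counit_kLam, one_smul,
        mul_one] at this
    refine (left_inv_eq_right_inv ?_ h1).symm
    rw [rhoInv, ← map_mul, Units.inv_mul, map_one]
  have hV : fundRep N q (Uq.kLam N q (Uq.twoRho N) : Uq N q) * rhoInv N q = 1 := by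
    rw [rhoInv, ← map_mul, Units.mul_inv, map_one]
  have hP : ∀ X i j, Gr.eval r X (grModular r N q (grProj r N q i j)) =
      (rhoInv N q * adR N q (coordProj r N) X * fundRep N q (Uq.kLam N q (Uq.twoRho N))) i j := by
    intro X i j
    have h1 := Gr.incl_grModular (grProj r N q i j) X
    rw [← Gr.eval_apply, ← Gr.eval_apply, eval_grProj, adR_mul] at h1
    rw [h1, adR, LinearMap.comp_apply, Uq.comul_kLam, sandwich_tmul, hS]
    rfl
  ext1 i j
  refine Gr.eval_ext fun X => ?_
  have key : (rhoInv N q * adR N q (coordProj r N) X *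
      fundRep N q (Uq.kLam N q (Uq.twoRho N))) * rhoInv N q =
      rhoInv N q * adR N q (coordProj r N) X := by
    rw [mul_assoc, hV, mul_one]
  have := congrFun (congrFun key i) j
  rw [Matrix.mul_apply, Matrix.mul_apply (M := rhoInv N q)] at this
  simp only [Matrix.mul_apply (M := Matrix.map _ _), map_sum, Matrix.map_apply,
    ← Algebra.commutes, ← Algebra.smul_def, map_smul, eval_grProj, smul_eq_mul, hP]
  rw [← this]
  exact Finset.sum_congr rfl fun k _ => mul_comm _ _

/-- At the base point `P` becomes the coordinate projection `p`, and its derivatives along `E_r` and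
`F_r` become the off-diagonal matrices `E_r` and `-K_r F_r`. The pairing is therefore the trace of
`V(2p - 1) E_r (-K_r F_r)`, which sees only the basis vector `v_r`. -/
theorem cupCochain_chainC (hr : 1 ≤ r) (hrN : r < N) :
    cupCochain (Gr.eval r 1) (Gr.eval r (Uq.E ⟨r - 1, by omega⟩)) (Gr.eval r (Uq.F ⟨r - 1, by omega⟩))
      (chainC (rhoInv N q) (grProj r N q)) = -(q : ℂ) ^ (2 * (r : ℤ) - 2 - N) := by
  have hq : (q : ℂ) ≠ 0 := Uq.q_ne_zero Fact.out
  have hs : (Real.sqrt q : ℂ) ≠ 0 := by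
    exact_mod_cast (Real.sqrt_pos.2 (Fact.out : 0 < q)).ne'
  set k : Fin (N - 1) := ⟨r - 1, by omega⟩ with hk
  have hkr : (k : ℕ) + 1 = r := by rw [hk]; simp only; omega
  have hKp : Commute (coordProj r N) (fundK N q k) := commute_diagonal_fundK _ k
  -- The derivative is the commutator `pE - Ep`. Here `E_r` sends `v_(r+1)` to `v_r` and kills the
  -- range of `p`, so `pE = E` and `Ep = 0`; for `F_r` the roles are exchanged.
  have hE : adR N q (coordProj r N) (Uq.E k) = fundE N q k := by
    rw [adR_E, mul_assoc, hKp.eq, neg_mul, mul_assoc, ← mul_assoc (fundKinv N q k),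
      fundKinv_mul_fundK, one_mul, fundE_coordProj, coordProj_fundE, if_neg (by omega),
      if_pos (by omega), neg_zero, zero_add]
  have hF : adR N q (coordProj r N) (Uq.F k) = -(fundK N q k * fundF N q k) := by
    rw [adR_F, mul_assoc _ (coordProj r N), neg_mul, mul_assoc, fundF_coordProj, coordProj_fundF,
      if_pos (by omega), if_neg (by omega), mul_zero, add_zero]
  have h1 : ∀ i j, Gr.eval r 1 (((rhoInv N q).map (algebraMap ℂ (Gr r N q)) *
      (2 • grProj r N q - 1) : Matrix (Fin N) (Fin N) (Gr r N q)) i j) =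
      (rhoInv N q * (2 • coordProj r N - 1) : Matrix (Fin N) (Fin N) ℂ) i j := by
    intro i j
    simp only [Matrix.mul_apply, map_sum, Matrix.map_apply, ← Algebra.smul_def, map_smul,
      Matrix.sub_apply, Matrix.smul_apply, map_sub, map_nsmul, eval_grProj, adR_one, smul_eq_mul,
      Matrix.one_apply]
    refine Finset.sum_congr rfl fun l _ => ?_
    congr 2
    split_ifs
    · rw [← map_one (algebraMap ℂ (Gr r N q)), Gr.eval_algebraMap, Bialgebra.counit_one, one_mul]
    · rw [map_zero]
  have h2 : cupCochain (Gr.eval r 1) (Gr.eval r (Uq.E k)) (Gr.eval r (Uq.F k))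
      (chainC (rhoInv N q) (grProj r N q)) =
      Matrix.trace (rhoInv N q * (2 • coordProj r N - 1) *
        (fundE N q k * -(fundK N q k * fundF N q k))) := by
    simp only [chainC, map_sum, cupCochain_tmul, h1, eval_grProj, hE, hF, Matrix.trace,
      Matrix.diag]
    refine Finset.sum_congr rfl fun j _ => ?_
    rw [Matrix.mul_apply]
    refine Finset.sum_congr rfl fun i _ => ?_
    rw [Matrix.mul_apply (M := fundE N q k), Finset.mul_sum]
  have h3 : fundE N q k * -(fundK N q k * fundF N q k) =
      Matrix.single ⟨k, by omega⟩ ⟨k, by omega⟩ (-(q : ℂ)⁻¹) := by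
    -- The image of `F_r` is spanned by `v_(r+1)`, on which `K_r` acts by `q⁻¹`.
    have hKF : fundK N q k * fundF N q k = (q : ℂ)⁻¹ • fundF N q k := by
      ext a b
      simp only [fundK, fundF, Matrix.diagonal_mul, Matrix.smul_apply, Matrix.single_apply,
        Fin.ext_iff, smul_eq_mul]
      split_ifs with h
      · simp [fundWeight, ← h.1]
      · simp
    rw [hKF, fundE, fundF, mul_neg, mul_smul_comm, Matrix.single_mul_single_same,
      inv_mul_cancel₀ hs, Matrix.smul_single, smul_eq_mul, mul_one]
    exact Matrix.single_neg _ _ _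
  rw [h2, h3, rhoInv_eq, Matrix.trace_mul_single]
  simp only [Matrix.diagonal_mul, Matrix.sub_apply, Matrix.smul_apply, coordProj,
    Matrix.diagonal_apply_eq, Matrix.one_apply_eq]
  rw [if_pos (by omega), ← hkr]
  -- The exponent splits into the weight of `V` on `v_r`, whose zero-based index is `k = r - 1`, and
  -- the `q⁻¹` coming from `K_r F_r`.
  have he : 2 * (((k : ℕ) + 1 : ℕ) : ℤ) - 2 - N = (2 * (k : ℤ) + 1 - N) + (-1) := by
    push_cast; ring
  rw [he, zpow_add₀ hq, zpow_neg_one]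
  norm_num

end grassmannian
end
end QGrass

/-! ### Assembly of the statement -/

open QGrass
theorem mainTheorem8 (r N : ℕ) (hr : 1 ≤ r) (hrN : r < N) (q : ℝ) [Fact (0 < q)] [Fact (q ≠ 1)] :
    -- the vector `w` is invariant under the Levi factor
    (∀ X ∈ Uq.levi N q {k | (k : ℕ) + 1 ≠ r},
      tensorAct N q X (invVec r N) = Coalgebra.counit (R := ℂ) X • invVec r N) ∧
    -- the matrix `P` has entries in the coordinate ring of the quantum Grassmannian
    ∃ P : Matrix (Fin N) (Fin N) (Gr r N q),
      (∀ i j, Gr.incl r N q (P i j) = projP r N q i j) ∧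
      (∀ i j, dualStar (Gr.incl r N q (P j i)) = Gr.incl r N q (P i j)) ∧
      P * P = P ∧
      Matrix.trace ((rhoInv N q).map (algebraMap ℂ (Gr r N q)) * P) =
        algebraMap ℂ (Gr r N q) ((q : ℂ) ^ ((r : ℤ) - (N : ℤ)) * (qInt q r : ℂ)) ∧
      -- `C(P)` is a cycle of the normalized complex with non-trivial class, and this class comes
      -- from a unique class `h`, again non-trivial, of the twisted Hochschild homology
      ∃ hC : IsNormCycle (grModular r N q) (chainC (rhoInv N q) P),
        normClass (grModular r N q) (chainC (rhoInv N q) P) hC ≠ 0 ∧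
        ∃ h : HH2 (grModular r N q),
          (∀ h' : HH2 (grModular r N q), toNorm (grModular r N q) h' =
            normClass (grModular r N q) (chainC (rhoInv N q) P) hC ↔ h' = h) ∧
          h ≠ 0 := by
  have hC : IsNormCycle (grModular r N q) (chainC (rhoInv N q) (grProj r N q)) :=
    chainC_isNormCycle _ _ _ grProj_mul_grProj grModular_grProj_mul_rhoInv
      (trace_rhoInv_mul_grProj hrN.le)
  have hne : normClass (grModular r N q) (chainC (rhoInv N q) (grProj r N q)) hC ≠ 0 := by
    -- The zero-based index `r - 1` is the simple root missing from the Levi factor; the hypotheses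
    -- `1 ≤ r` and `r < N` make it a valid index.
    refine normClass_ne_zero _ (Gr.eval r 1) (Gr.eval r (Uq.E ⟨r - 1, by omega⟩))
      (Gr.eval r (Uq.F ⟨r - 1, by omega⟩)) ?_ Gr.eval_one_mul (fun a => ?_) (Gr.eval_E_mul _)
      (Gr.eval_F_mul _) _ hC ?_
    · rw [← map_one (algebraMap ℂ (Gr r N q)), Gr.eval_algebraMap, Bialgebra.counit_one, one_mul]
    · rw [Gr.eval_apply, Gr.incl_grModular, one_mul, Gr.incl_levi a (Uq.kLam_mem_levi _ _),
        Uq.counit_kLam, one_mul, Gr.eval_apply]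
    · rw [cupCochain_chainC hr hrN]
      exact neg_ne_zero.2 (zpow_ne_zero _ (Uq.q_ne_zero Fact.out))
  refine ⟨fun X hX => tensorAct_invVec hX, grProj r N q, incl_grProj,
    fun i j => dualStar_projP r i j, grProj_mul_grProj, trace_rhoInv_mul_grProj hrN.le, hC, hne, ?_⟩
  -- Existence comes from surjectivity and uniqueness from injectivity; `h = 0` would force the
  -- normalized class to vanish.
  obtain ⟨h, hh⟩ := toNorm_surjective _ (normClass _ _ hC)
  refine ⟨h, fun h' => ⟨fun e => toNorm_injective _ (e.trans hh.symm), fun e => e ▸ hh⟩, ?_⟩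
  rintro rfl
  exact hne (by rw [← hh, map_zero])
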